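/- Let $\Phi$ be an irreducible reduced crystallographic root system in a real vector space $V$, with coroots in $V^*$, Weyl group $W$ and simple roots $\Pi$. Let $\Phi^+$ be the corresponding set of positive roots and $\alpha_0$ the highest root. Let $P^\vee=\{\lambda\in V^* : \langle\lambda,\alpha\rangle\in\mathbb Z\ \forall\alpha\in\Phi\}$ be the coweight lattice, let $\widehat{W}_{\mathrm a}=\mathrm t(P^\vee)\rtimes W$ be the extended affine Weyl group acting on $V^*$ by affine transformations (where $\mathrm t_v$ is the translation by $v$), and let $$\Omega=\{\phi\in\widehat{W}_{\mathrm a} : \phi(\mathcal A_0)=\mathcal A_0\},\qquad \mathcal A_0=\{\lambda\in V^* : 0\le\langle\lambda,\alpha\rangle\le 1\ \ \forall\alpha\in\Phi^+\},$$ be the stabilizer of the closed fundamental alcove. Let $\mathcal D$ be the Dynkin diagram of $\Phi$, with vertex set $\Pi$, and let $\widehat{\mathcal D}$ be the extended Dynkin diagram, with vertex set $\Pi\cup\{-\alpha_0\}$. In both, distinct vertices $\alpha,\beta$ are joined by $\langle\alpha^\vee,\beta\rangle\langle\beta^\vee,\alpha\rangle$ bonds, with an arrow towards the shorter root when the lengths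 of two joined roots differ. An automorphism of a diagram is a permutation of its vertices that preserves the bonds with their multiplicities and the arrows. Then: 1. For every $\omega=\mathrm t_v w\in\Omega$ (with $v\in P^\vee$, $w\in W$), the Weyl part $w$ permutes the vertices of $\widehat{\mathcal D}$, and this defines an injective group homomorphism $\Omega\hookrightarrow\mathrm{Aut}(\widehat{\mathcal D})$ whose image is a normal subgroup. 2. Every automorphism of $\mathcal D$ extends to an automorphism of $\widehat{\mathcal D}$ fixing the vertex $-\alpha_0$. This gives an injective homomorphism $\mathrm{Aut}(\mathcal D)\hookrightarrow\mathrm{Aut}(\widehat{\mathcal D})$ whose image is the stabilizer of $-\alpha_0$, and the composite $\mathrm{Aut}(\mathcal D)\hookrightarrow\mathrm{Aut}(\widehat{\mathcal D})\twoheadrightarrow\mathrm{Aut}(\widehat{\mathcal D})/\Omega$ is an isomorphism. 3. Consequently $\mathrm{Aut}(\widehat{\mathcal D})\simeq\Omega\rtimes\mathrm{Aut}(\mathcal D)$, the isomorphism being $(\omega,\theta)\mapsto\omega\,\theta$ through the two inclusions above. -/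

import Mathlib

namespace AffineDynkin

noncomputable section

/-- A Dynkin-type diagram on a vertex set `S`: a number of bonds between any two vertices, and a
relation recording which (multiple) bonds carry an arrow, and in which direction. -/
structure Diagram (S : Type*) where
  bonds : S → S → ℕ
  arrow : S → S → Prop

/-- The automorphism group of a diagram: the permutations of the vertices that preserve the bonds
with their multiplicities and the arrows with their directions. -/
def Diagram.aut {S : Type*} (D : Diagram S) : Subgroup (Equiv.Perm S) where
  carrier := {σ | (∀ i j, D.bonds (σ i) (σ j) = D.bonds i j) ∧
    ∀ i j, D.arrow (σ i) (σ j) ↔ D.arrow i j}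
  mul_mem' := by
    intro σ τ hσ hτ
    refine ⟨fun i j => ?_, fun i j => ?_⟩
    · rw [Equiv.Perm.mul_apply, Equiv.Perm.mul_apply, hσ.1, hτ.1]
    · rw [Equiv.Perm.mul_apply, Equiv.Perm.mul_apply, hσ.2, hτ.2]
  one_mem' := ⟨fun _ _ => rfl, fun _ _ => Iff.rfl⟩
  inv_mem' := by
    intro σ hσ
    refine ⟨fun i j => ?_, fun i j => ?_⟩
    · rw [← hσ.1, ← Equiv.Perm.mul_apply, ← Equiv.Perm.mul_apply, mul_inv_cancel]; rfl
    · rw [← hσ.2, ← Equiv.Perm.mul_apply, ← Equiv.Perm.mul_apply, mul_inv_cancel]; rfl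

variable {ι V V' : Type*} [AddCommGroup V] [Module ℝ V] [AddCommGroup V'] [Module ℝ V']

/-- The diagram of a set of roots: distinct roots `α`, `β` are joined by
`⟨β^∨, α⟩ ⟨α^∨, β⟩` bonds, and there is an arrow from `α` to `β` when they are joined and `α` is the
longer one, that is, when `|⟨β^∨, α⟩| > |⟨α^∨, β⟩|`. -/
def rootDiagram (P : RootPairing ι ℝ V V') [P.IsCrystallographic] (S : Set ι) : Diagram S where
  bonds i j := open Classical in
    if i = j then 0 else (P.pairingIn ℤ i j * P.pairingIn ℤ j i).natAbs
  arrow i j := (P.pairingIn ℤ j i).natAbs < (P.pairingIn ℤ i j).natAbs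

section Base

variable {P : RootPairing ι ℝ V V'} (b : P.Base)

/-- The root with index `i` is positive: a sum of simple roots. -/
def IsPositive (i : ι) : Prop := P.root i ∈ AddSubmonoid.closure (P.root '' b.support)

/-- The root with index `h` is the highest root `α₀`: for every root `α`, the difference `α₀ - α` is
a (possibly empty) sum of simple roots. -/
def IsHighest (h : ι) : Prop :=
  ∀ i, P.root h - P.root i ∈ AddSubmonoid.closure (P.root '' b.support)

/-- The root with index `i` is the lowest root `-α₀`. -/
def IsLowest (i : ι) : Prop := ∃ h, IsHighest b h ∧ P.root i = -P.root h

/-- Vertices of the Dynkin diagram: the simple roots. -/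
def simpleIdx : Set ι := {i | i ∈ b.support}

/-- Vertices of the extended Dynkin diagram: the simple roots and the lowest root. -/
def extendedIdx : Set ι := {i | i ∈ b.support ∨ IsLowest b i}

/-- Each vertex of the Dynkin diagram is a vertex of the extended one. -/
def toExtended (i : simpleIdx b) : extendedIdx b := ⟨i.1, Or.inl i.2⟩

/-- The (finite) Dynkin diagram. -/
def dynkin [P.IsCrystallographic] : Diagram (simpleIdx b) := rootDiagram P (simpleIdx b)

/-- The extended Dynkin diagram. -/
def extendedDynkin [P.IsCrystallographic] : Diagram (extendedIdx b) :=
  rootDiagram P (extendedIdx b)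

/-- The closed fundamental alcove in the coroot space. -/
def fundamentalAlcove : Set V' :=
  {x | ∀ i, IsPositive b i → 0 ≤ P.toLinearMap (P.root i) x ∧ P.toLinearMap (P.root i) x ≤ 1}

end Base

variable (P : RootPairing ι ℝ V V')

/-- The coweight lattice: the vectors of the coroot space with integral pairing with all roots. -/
def coweightLattice : AddSubgroup V' where
  carrier := {x | ∀ i, ∃ n : ℤ, P.toLinearMap (P.root i) x = n}
  add_mem' := by
    intro x y hx hy i
    obtain ⟨m, hm⟩ := hx i
    obtain ⟨n, hn⟩ := hy i
    exact ⟨m + n, by rw [map_add, hm, hn]; push_cast; rfl⟩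
  zero_mem' := fun i => ⟨0, by simp⟩
  neg_mem' := by
    intro x hx i
    obtain ⟨m, hm⟩ := hx i
    exact ⟨-m, by rw [map_neg, hm]; push_cast; rfl⟩

/-- The (left) action of the Weyl group on the coroot space, contragredient to its action on the
root space. -/
def coweightAction : P.weylGroup →* (V' ≃ₗ[ℝ] V') where
  toFun w := ((RootPairing.Equiv.coweightHom P) (w⁻¹ : P.weylGroup)).unop
  map_one' := by rw [inv_one, Subgroup.coe_one, map_one]; rfl
  map_mul' x y := by
    rw [mul_inv_rev, Subgroup.coe_mul, map_mul, MulOpposite.unop_mul]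

/-- The Weyl group acts compatibly with the pairing of the root space and the coroot space. -/
theorem toLinearMap_coweightAction (w : P.weylGroup) (m : V) (x : V') :
    P.toLinearMap m (coweightAction P w x) = P.toLinearMap (w⁻¹ • m) x := by
  have h := (w⁻¹ : P.weylGroup).1.weight_coweight_transpose
  exact (LinearMap.congr_fun (LinearMap.congr_fun h x) m).symm

theorem coweightAction_mem (w : P.weylGroup) {x : V'} (hx : x ∈ coweightLattice P) :
    coweightAction P w x ∈ coweightLattice P := by
  intro i
  rw [toLinearMap_coweightAction, RootPairing.weylGroup_apply_root]
  exact hx _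

/-- `f = t_v ∘ w` as maps on the coroot space. -/
def IsTranslateOf (f : V' ≃ᵃ[ℝ] V') (v : V') (w : P.weylGroup) : Prop :=
  ∀ x, f x = coweightAction P w x + v

/-- The extended affine Weyl group: the affine transformations `t_v ∘ w` of the coroot space with
`v` in the coweight lattice and `w` in the Weyl group. -/
def extendedAffineWeylGroup : Subgroup (V' ≃ᵃ[ℝ] V') where
  carrier := {f | ∃ v ∈ coweightLattice P, ∃ w : P.weylGroup, IsTranslateOf P f v w}
  mul_mem' := by
    rintro f g ⟨v, hv, w, hf⟩ ⟨v', hv', w', hg⟩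
    refine ⟨coweightAction P w v' + v, add_mem (coweightAction_mem P w hv') hv, w * w', ?_⟩
    intro x
    rw [AffineEquiv.coe_mul, Function.comp_apply, hf, hg, map_add, map_mul, LinearEquiv.mul_apply,
      add_assoc]
  one_mem' := ⟨0, zero_mem _, 1, fun x => by simp⟩
  inv_mem' := by
    rintro f ⟨v, hv, w, hf⟩
    refine ⟨-coweightAction P w⁻¹ v, neg_mem (coweightAction_mem P _ hv), w⁻¹, ?_⟩
    intro x
    have key : ∀ y, coweightAction P w (coweightAction P w⁻¹ y) = y := fun y => by
      rw [← LinearEquiv.mul_apply, ← map_mul, mul_inv_cancel, map_one]; rfl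
    apply f.injective
    rw [AffineEquiv.inv_def, AffineEquiv.apply_symm_apply, hf, map_add, map_neg, key, key]
    abel

variable {P}

/-- The group `Ω`: the stabilizer of the fundamental alcove in the extended affine Weyl group. -/
def Omega (b : P.Base) : Subgroup (V' ≃ᵃ[ℝ] V') where
  carrier := {f | f ∈ extendedAffineWeylGroup P ∧
    f '' fundamentalAlcove b = fundamentalAlcove b}
  mul_mem' := by
    rintro f g ⟨hf, hf'⟩ ⟨hg, hg'⟩
    refine ⟨mul_mem hf hg, ?_⟩
    rw [AffineEquiv.coe_mul, Set.image_comp, hg', hf']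
  one_mem' := ⟨one_mem _, by simp⟩
  inv_mem' := by
    rintro f ⟨hf, hf'⟩
    refine ⟨inv_mem hf, ?_⟩
    conv_lhs => rw [← hf']
    rw [← Set.image_comp, ← AffineEquiv.coe_mul, inv_mul_cancel]
    simp

end

end AffineDynkin

/-! Everything is computed inside the automorphism group `P.Aut` of the root system. Write Π̂ for
the simple roots together with -α₀. The three groups become subgroups of `P.Aut`: Aut(D̂) is the
stabilizer of Π̂, Aut(D) is the stabilizer of Π (contained in the former, since α₀ is determined by
Π), and Ω is the intersection of W with the stabilizer of Π̂.

For the diagrams, distinct vertices are at non-acute angles, so bonds and arrows determine the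
Cartan integers, and a diagram automorphism extends linearly from the simple roots to an
automorphism of Φ (`exists_aut_of_pairing_eq`). For D̂ the image of -α₀ must also be right. The
linear relations between the vertices form a line, spanned by the marks (the coefficients of α₀, and
1 at -α₀). A diagram automorphism preserves this line, and integrality of the marks forces it to
preserve the marks themselves (`mark_perm`).

For Ω, the affine functions with root linear part and integral constant term that are nonnegative on
the alcove are sums of simple affine roots. An element of Ω permutes these functions, hence their
indecomposable elements, and its Weyl part permutes Π̂ (`IsTranslateOf.weyl_mem_rootStabilizer`).
Conversely, if w in W permutes Π̂ and moves -α₀ to a simple root, that root has mark 1, and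
translating by the corresponding fundamental coweight after w restores the alcove
(`exists_coweight_affineShift`).

The rest is group theory: W is normal in `P.Aut`, every automorphism is a Weyl element times one
preserving Π, and a Weyl element preserving Π is trivial. Intersecting with the stabilizer of Π̂
gives the normality of Ω and the complement Aut(D). -/

namespace AffineDynkin

open RootPairing Module Set

/-! ### Automorphisms of root systems and normality of the Weyl group. -/

section Automorphisms

variable {ι V V' : Type*} [AddCommGroup V] [Module ℝ V] [AddCommGroup V']
  [Module ℝ V'] {P : RootPairing ι ℝ V V'}

theorem root_smul (g : P.Aut) (i : ι) : P.root (g • i) = g • P.root i :=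
  RootPairing.Equiv.root_indexEquiv_eq_smul (P := P) i g

theorem toLinearMap_smul (g : P.Aut) (m : V) (x : V') :
    P.toLinearMap (g • m) x = P.toLinearMap m (g.coweightMap x) :=
  LinearMap.congr_fun (LinearMap.congr_fun g.weight_coweight_transpose x) m

theorem coweightMap_coroot (g : P.Aut) (i : ι) :
    g.coweightMap (P.coroot (g • i)) = P.coroot i := by
  have h := congr_fun g.coroot_coweightMap (g • i)
  have h2 : g.indexEquiv.symm (g • i) = i := g.indexEquiv.symm_apply_apply i
  simpa [h2] using h

theorem pairing_smul_smul (g : P.Aut) (i j : ι) : P.pairing (g • i) (g • j) = P.pairing i j := by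
  rw [← P.root_coroot_eq_pairing, ← P.root_coroot_eq_pairing, root_smul, toLinearMap_smul,
    coweightMap_coroot]

theorem pairingIn_smul_smul [P.IsCrystallographic] (g : P.Aut) (i j : ι) :
    P.pairingIn ℤ (g • i) (g • j) = P.pairingIn ℤ i j := by
  apply FaithfulSMul.algebraMap_injective ℤ ℝ
  rw [algebraMap_pairingIn, algebraMap_pairingIn, pairing_smul_smul]

theorem coroot'_smul (g : P.Aut) (i : ι) (m : V) :
    P.coroot' (g • i) (g • m) = P.coroot' i m := by
  change P.toLinearMap (g • m) (P.coroot (g • i)) = P.toLinearMap m (P.coroot i)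
  rw [toLinearMap_smul, coweightMap_coroot]

theorem smul_reflection (g : P.Aut) (i : ι) (m : V) :
    g • P.reflection i m = P.reflection (g • i) (g • m) := by
  rw [P.reflection_apply, P.reflection_apply, coroot'_smul, smul_sub, smul_comm, root_smul]

theorem aut_ext {g h : P.Aut} (H : ∀ m : V, g • m = h • m) : g = h :=
  RootPairing.Equiv.weightHom_injective P (LinearEquiv.ext H)

theorem conj_reflection (g : P.Aut) (i : ι) :
    g * Equiv.reflection P i * g⁻¹ = Equiv.reflection P (g • i) := by
  refine aut_ext fun m => ?_
  rw [mul_smul, mul_smul, Equiv.reflection_smul, smul_reflection, smul_inv_smul,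
    Equiv.reflection_smul]

/-- Conjugating the reflection in a root by an automorphism gives the reflection in the image root.
-/
instance weylGroup_normal : P.weylGroup.Normal := by
  refine ⟨fun w hw g => ?_⟩
  induction hw using weylGroup.induction with
  | mem i => rw [conj_reflection]; exact P.reflection_mem_weylGroup _
  | one => simp
  | mul x y hx hy ihx ihy =>
    have : g * (x * y) * g⁻¹ = g * x * g⁻¹ * (g * y * g⁻¹) := by group
    rw [this]; exact mul_mem ihx ihy

theorem smul_index_eq_of_root_eq {g : P.Aut} {i j : ι} (h : g • P.root i = P.root j) :
    g • i = j :=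
  P.root.injective (by rw [root_smul, h])

/-- Automorphisms that agree on the simple roots are equal. -/
theorem aut_ext_of_support [P.IsRootSystem] (b : P.Base) {g h : P.Aut}
    (H : ∀ i ∈ b.support, g • i = h • i) : g = h := by
  refine aut_ext fun m => ?_
  have : Equiv.weightHom P g = Equiv.weightHom P h := by
    apply LinearEquiv.toLinearMap_injective
    refine b.toWeightBasis.ext fun i => ?_
    rw [b.toWeightBasis_apply]
    change g • P.root i = h • P.root i
    rw [← root_smul, ← root_smul, H i i.2]
  exact LinearEquiv.congr_fun this m

theorem aut_finite [Finite ι] [P.IsRootSystem] (b : P.Base) : Finite P.Aut :=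
  Finite.of_injective (fun g : P.Aut => (fun i : ι => g • i))
    fun _ _ h => aut_ext_of_support b fun i _ => congr_fun h i

theorem exists_aut_of_linearEquiv [Finite ι] [P.IsRootSystem] (f : V ≃ₗ[ℝ] V)
    (hf : ∀ i, f (P.root i) ∈ range P.root) : ∃ g : P.Aut, ∀ m, g • m = f m := by
  choose e he using hf
  have hinj : Function.Injective e := fun i j hij =>
    P.root.injective (f.injective (by rw [← he, ← he, hij]))
  have : Module.IsTorsionFree ℝ V := inferInstance
  exact ⟨Equiv.mk' P P f (Equiv.ofBijective e (Finite.injective_iff_bijective.mp hinj))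
    fun i => (he i).symm, fun m => rfl⟩

/-- The linear map prescribed on the simple roots intertwines simple reflections with reflections in
the `σ i`. Every root is reached from simple ones by simple reflections, so roots go to roots. The
map is injective because the simple coroots separate points. -/
theorem exists_aut_of_pairing_eq [Finite ι] [P.IsRootSystem] [P.IsCrystallographic]
    [P.IsReduced] (b : P.Base) (σ : b.support → ι)
    (hσ : ∀ i j, P.pairing (σ i) (σ j) = P.pairing i j) :
    ∃ g : P.Aut, ∀ i : b.support, g • (i : ι) = σ i := by
  let f : V →ₗ[ℝ] V := b.toWeightBasis.constr ℝ fun i => P.root (σ i)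
  have hf (i : b.support) : f (P.root i) = P.root (σ i) := by
    rw [← b.toWeightBasis_apply, Basis.constr_basis]
  have hc (j : b.support) (m : V) : P.coroot' (σ j) (f m) = P.coroot' j m := by
    have : (P.coroot' (σ j)) ∘ₗ f = P.coroot' j := by
      refine b.toWeightBasis.ext fun i => ?_
      rw [b.toWeightBasis_apply, LinearMap.comp_apply, hf, root_coroot'_eq_pairing,
        root_coroot'_eq_pairing, hσ]
    exact LinearMap.congr_fun this m
  have hr (j : b.support) (m : V) : f (P.reflection j m) = P.reflection (σ j) (f m) := by
    rw [P.reflection_apply, P.reflection_apply, map_sub, map_smul, hf, hc]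
  have hinj : Function.Injective f := by
    rw [injective_iff_map_eq_zero]
    intro m hm
    have h0 (j : b.support) : P.coroot' j m = 0 := by rw [← hc, hm, map_zero]
    have h1 : P.toLinearMap m = 0 := by
      refine b.toCoweightBasis.ext fun j => ?_
      rw [b.toCoweightBasis_apply]
      exact h0 j
    exact P.toPerfPair.injective (by rw [map_zero]; exact h1)
  have : FiniteDimensional ℝ V := b.toWeightBasis.finiteDimensional_of_finite
  obtain ⟨g, hg⟩ := exists_aut_of_linearEquiv (P := P) (LinearEquiv.ofInjectiveEndo f hinj)
    fun i => by
      change f (P.root i) ∈ range P.root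
      apply b.induction_reflect i
      · rintro j ⟨k, hk⟩
        exact ⟨P.reflectionPerm k k, by
          rw [root_reflectionPerm, root_reflectionPerm, P.reflection_apply_self,
            P.reflection_apply_self, hk, map_neg]⟩
      · exact fun j hj => ⟨σ ⟨j, hj⟩, (hf ⟨j, hj⟩).symm⟩
      · rintro j k ⟨l, hl⟩ hk
        refine ⟨P.reflectionPerm (σ ⟨k, hk⟩) l, ?_⟩
        rw [root_reflectionPerm, root_reflectionPerm, hr ⟨k, hk⟩, hl]
  exact ⟨g, fun i => smul_index_eq_of_root_eq ((hg _).trans (hf i))⟩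

end Automorphisms

/-- An additive automorphism `T` permutes a set `F` of elements of height one as soon as `T` and its
inverse map `F` into the monoid generated by `F`. -/
theorem apply_mem_of_mem_closure {A : Type*} [AddCommGroup A] (F : Set A) (T : A ≃+ A)
    (H : A →+ ℝ) (hH : ∀ f ∈ F, H f = 1) (hT : ∀ f ∈ F, T f ∈ AddSubmonoid.closure F)
    (hT' : ∀ f ∈ F, T.symm f ∈ AddSubmonoid.closure F) {f : A} (hf : f ∈ F) : T f ∈ F := by
  have split : ∀ x ∈ AddSubmonoid.closure F,
      x = 0 ∨ ∃ f ∈ F, ∃ y ∈ AddSubmonoid.closure F, x = f + y := by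
    intro x hx
    induction hx using AddSubmonoid.closure_induction with
    | mem x hx => exact Or.inr ⟨x, hx, 0, zero_mem _, (add_zero x).symm⟩
    | zero => exact Or.inl rfl
    | add x y _ hy ihx ihy =>
      rcases ihx with rfl | ⟨f, hf, z, hz, rfl⟩
      · simpa using ihy
      · exact Or.inr ⟨f, hf, z + y, add_mem hz hy, add_assoc _ _ _⟩
  have nonneg : ∀ x ∈ AddSubmonoid.closure F, 0 ≤ H x := by
    intro x hx
    induction hx using AddSubmonoid.closure_induction with
    | mem x hx => rw [hH x hx]; exact zero_le_one
    | zero => simp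
    | add x y _ _ ihx ihy => rw [map_add]; exact add_nonneg ihx ihy
  have one_le : ∀ x ∈ AddSubmonoid.closure F, x ≠ 0 → 1 ≤ H x := by
    intro x hx h0
    obtain ⟨f, hf, y, hy, rfl⟩ := (split x hx).resolve_left h0
    rw [map_add, hH f hf]
    linarith [nonneg y hy]
  have closed : ∀ x ∈ AddSubmonoid.closure F, T.symm x ∈ AddSubmonoid.closure F := by
    intro x hx
    induction hx using AddSubmonoid.closure_induction with
    | mem x hx => exact hT' x hx
    | zero => simp
    | add x y _ _ ihx ihy => rw [map_add]; exact add_mem ihx ihy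
  have ne_zero : ∀ f ∈ F, f ≠ 0 := by
    rintro f hf rfl
    simpa using hH 0 hf
  -- Write T f = f' + y. Pulling back by T, the height 1 of f is the sum of the heights of T⁻¹ f'
  -- and T⁻¹ y. The first is at least 1, so the second leaves no room for a nonzero term and y = 0.
  obtain ⟨f', hf', y, hy, hfy⟩ := (split _ (hT f hf)).resolve_left
    fun h => ne_zero f hf (T.injective (by rw [h, map_zero]))
  have h1 : 1 ≤ H (T.symm f') := one_le _ (hT' f' hf') fun h =>
    ne_zero f' hf' (T.symm.injective (by rw [h, map_zero]))
  have h2 : f = T.symm f' + T.symm y := by rw [← map_add, ← hfy, T.symm_apply_apply]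
  have h3 : T.symm y = 0 := by
    by_contra h
    have h4 := congrArg H h2
    rw [hH f hf, map_add] at h4
    linarith [one_le _ (closed y hy) h]
  have h5 : y = 0 := T.symm.injective (by rw [h3, map_zero])
  rwa [hfy, h5, add_zero]

/-! ### Positive roots, the exchange property, and Aut(Φ) = W · Stab(Π). -/

section Positivity

variable {ι V V' : Type*} [AddCommGroup V] [Module ℝ V] [AddCommGroup V'] [Module ℝ V']
  {P : RootPairing ι ℝ V V'} (b : P.Base)

/-- The monoid of sums of simple roots. -/
def posMonoid : AddSubmonoid V := AddSubmonoid.closure (P.root '' b.support)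

theorem root_mem_posMonoid {i : ι} (hi : i ∈ b.support) : P.root i ∈ posMonoid b :=
  AddSubmonoid.subset_closure ⟨i, hi, rfl⟩

theorem smul_mem_posMonoid {g : P.Aut} (hg : ∀ i ∈ b.support, g • P.root i ∈ posMonoid b) {m : V}
    (hm : m ∈ posMonoid b) : g • m ∈ posMonoid b := by
  induction hm using AddSubmonoid.closure_induction with
  | mem x hx => obtain ⟨i, hi, rfl⟩ := hx; exact hg i hi
  | zero => rw [smul_zero]; exact zero_mem _
  | add x y _ _ ihx ihy => rw [smul_add]; exact add_mem ihx ihy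

variable [P.IsRootSystem]

/-- The height, as a linear functional on the root space. -/
noncomputable def heightFunctional : V →ₗ[ℝ] ℝ := b.toWeightBasis.constr ℝ fun _ => 1

theorem heightFunctional_root {i : ι} (hi : i ∈ b.support) :
    heightFunctional b (P.root i) = 1 := by
  rw [← b.toWeightBasis_apply ⟨i, hi⟩, heightFunctional, Basis.constr_basis]

/-- The gap between 0 and 1 makes the monoid pointed and turns sign information on heights into
positivity of roots. -/
theorem one_le_heightFunctional {m : V} (hm : m ∈ posMonoid b) :
    m = 0 ∨ 1 ≤ heightFunctional b m := by
  induction hm using AddSubmonoid.closure_induction with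
  | mem x hx =>
    obtain ⟨i, hi, rfl⟩ := hx
    exact Or.inr (heightFunctional_root b hi).ge
  | zero => exact Or.inl rfl
  | add x y _ _ ihx ihy =>
    rcases ihx with rfl | ihx
    · simpa using ihy
    · rcases ihy with rfl | ihy
      · simpa using Or.inr ihx
      · rw [map_add]; right; linarith

theorem heightFunctional_nonneg {m : V} (hm : m ∈ posMonoid b) : 0 ≤ heightFunctional b m := by
  rcases one_le_heightFunctional b hm with rfl | h
  · simp
  · linarith

theorem eq_zero_of_mem_of_neg_mem {m : V} (hm : m ∈ posMonoid b) (hm' : -m ∈ posMonoid b) :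
    m = 0 := by
  rcases one_le_heightFunctional b hm with h | h
  · exact h
  · have := heightFunctional_nonneg b hm'
    rw [map_neg] at this
    linarith

theorem neg_root_notMem {i : ι} (hi : P.root i ∈ posMonoid b) : -P.root i ∉ posMonoid b :=
  fun h => P.ne_zero i (eq_zero_of_mem_of_neg_mem b hi h)

/-- An automorphism mapping all simple roots to positive roots permutes the simple roots. -/
theorem smul_mem_support_iff [Finite ι] {g : P.Aut}
    (hg : ∀ i ∈ b.support, g • P.root i ∈ posMonoid b) (i : ι) :
    g • i ∈ b.support ↔ i ∈ b.support := by
  -- If g⁻¹ sent a positive root β to a negative one, g would send the positive root -g⁻¹β to the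
  -- negative root -β.
  have hpos : ∀ j, P.root j ∈ posMonoid b → g⁻¹ • P.root j ∈ posMonoid b := by
    intro j hj
    rw [← root_smul]
    refine (b.root_mem_or_neg_mem (g⁻¹ • j)).resolve_right fun h => ?_
    refine neg_root_notMem b hj ?_
    have := smul_mem_posMonoid b hg h
    rwa [smul_neg, ← root_smul, smul_inv_smul] at this
  have key : ∀ h : P.Aut, (∀ i ∈ b.support, h • P.root i ∈ posMonoid b) →
      (∀ i ∈ b.support, h⁻¹ • P.root i ∈ posMonoid b) → ∀ i ∈ b.support, h • i ∈ b.support := by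
    intro h h1 h2 i hi
    obtain ⟨j, hj, hij⟩ := apply_mem_of_mem_closure (P.root '' b.support)
      (DistribMulAction.toAddEquiv V h) (heightFunctional b).toAddMonoidHom
      (by rintro _ ⟨i, hi, rfl⟩; exact heightFunctional_root b hi)
      (by rintro _ ⟨i, hi, rfl⟩; exact h1 i hi)
      (by rintro _ ⟨i, hi, rfl⟩; exact h2 i hi) ⟨i, hi, rfl⟩
    rw [smul_index_eq_of_root_eq (show h • P.root i = P.root j from hij.symm)]
    exact hj
  have hg' : ∀ i ∈ b.support, g⁻¹ • P.root i ∈ posMonoid b := fun i hi =>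
    hpos i (root_mem_posMonoid b hi)
  refine ⟨fun h => ?_, key g hg hg' i⟩
  have := key g⁻¹ hg' (by rwa [inv_inv]) _ h
  rwa [inv_smul_smul] at this

variable [Finite ι] [P.IsCrystallographic] [P.IsReduced]

omit [P.IsReduced] in
theorem isPos_iff_mem_posMonoid (i : ι) : b.IsPos i ↔ P.root i ∈ posMonoid b := by
  have key : ∀ j, b.IsPos j → P.root j ∈ posMonoid b := fun j hj =>
    hj.induction_on_add (p := fun k => P.root k ∈ posMonoid b)
      (fun _ hk => root_mem_posMonoid b hk)
      (fun i j k hk hi hj => by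
        rw [hk]; exact add_mem hi (root_mem_posMonoid b hj))
  refine ⟨key i, fun hi => ?_⟩
  let := P.indexNeg
  refine (Base.IsPos.or_neg b i).resolve_right fun h => neg_root_notMem b hi ?_
  simpa using key _ h

theorem reflection_mem_posMonoid {i j : ι} (hi : P.root i ∈ posMonoid b) (hj : j ∈ b.support)
    (hij : i ≠ j) : P.reflection j (P.root i) ∈ posMonoid b := by
  rw [← root_reflectionPerm, ← isPos_iff_mem_posMonoid]
  exact ((isPos_iff_mem_posMonoid b i).mpr hi).reflectionPerm hj hij

omit [P.IsRootSystem] in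
-- Roots are obtained from simple ones by simple reflections, and moving a root by a reflection
-- conjugates its own reflection.
theorem reflection_mem_closure_simple (i : ι) :
    Equiv.reflection P i ∈ Subgroup.closure (Equiv.reflection P '' b.support) := by
  have hconj (i j : ι) : Equiv.reflection P (P.reflectionPerm j i) =
      Equiv.reflection P j * Equiv.reflection P i * (Equiv.reflection P j)⁻¹ :=
    (conj_reflection (Equiv.reflection P j) i).symm
  have hgen (i j : ι) (hi : Equiv.reflection P i ∈ Subgroup.closure
      (Equiv.reflection P '' b.support)) (hj : Equiv.reflection P j ∈ Subgroup.closure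
      (Equiv.reflection P '' b.support)) : Equiv.reflection P (P.reflectionPerm j i) ∈
      Subgroup.closure (Equiv.reflection P '' b.support) := by
    rw [hconj]
    exact mul_mem (mul_mem hj hi) (inv_mem hj)
  have hsimple (i : ι) (hi : i ∈ b.support) : Equiv.reflection P i ∈
      Subgroup.closure (Equiv.reflection P '' b.support) := Subgroup.subset_closure ⟨i, hi, rfl⟩
  exact b.induction_reflect i
    (p := fun i => Equiv.reflection P i ∈ Subgroup.closure (Equiv.reflection P '' b.support))
    (fun i hi => hgen i i hi hi) hsimple fun i j hi hj => hgen i j hi (hsimple j hj)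

omit [P.IsRootSystem] in
/-- The Weyl group is generated by the simple reflections. -/
theorem exists_list_prod_eq {w : P.Aut} (hw : w ∈ P.weylGroup) :
    ∃ L : List ι, (∀ i ∈ L, i ∈ b.support) ∧ (L.map (Equiv.reflection P)).prod = w := by
  have hw' : w ∈ Subgroup.closure (Equiv.reflection P '' b.support) := by
    refine (Subgroup.closure_le _).mpr ?_ hw
    rintro _ ⟨i, rfl⟩
    exact reflection_mem_closure_simple b i
  induction hw' using Subgroup.closure_induction with
  | mem x hx =>
    obtain ⟨i, hi, rfl⟩ := hx
    exact ⟨[i], by simpa using hi, by simp⟩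
  | one => exact ⟨[], by simp, rfl⟩
  | mul x y hx hy ihx ihy =>
    have hle : Subgroup.closure (Equiv.reflection P '' b.support) ≤ P.weylGroup :=
      Subgroup.closure_mono (image_subset_range _ _)
    obtain ⟨L, hL, rfl⟩ := ihx (hle hx)
    obtain ⟨L', hL', rfl⟩ := ihy (hle hy)
    refine ⟨L ++ L', fun i hi => ?_, by simp⟩
    rcases List.mem_append.mp hi with hi | hi
    exacts [hL i hi, hL' i hi]
  | inv x hx ihx =>
    have hle : Subgroup.closure (Equiv.reflection P '' b.support) ≤ P.weylGroup :=
      Subgroup.closure_mono (image_subset_range _ _)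
    obtain ⟨L, hL, rfl⟩ := ihx (hle hx)
    refine ⟨L.reverse, fun i hi => hL i (List.mem_reverse.mp hi), ?_⟩
    rw [List.prod_inv_reverse, List.map_reverse, List.map_map]
    congr 3
    funext i
    exact (Equiv.reflection_inv P i).symm

/-- The exchange property of the Weyl group. -/
theorem exists_exchange (L : List ι) (hL : ∀ i ∈ L, i ∈ b.support) {i : ι} (hi : i ∈ b.support)
    (hneg : -((L.map (Equiv.reflection P)).prod • P.root i) ∈ posMonoid b) :
    ∃ L' : List ι, (∀ i ∈ L', i ∈ b.support) ∧ L'.length < L.length ∧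
      (L'.map (Equiv.reflection P)).prod =
        (L.map (Equiv.reflection P)).prod * Equiv.reflection P i := by
  induction L with
  | nil =>
    exact absurd (by simpa using hneg) (neg_root_notMem b (root_mem_posMonoid b hi))
  | cons j L ih =>
    have hj := hL j (by simp)
    have hL' : ∀ i ∈ L, i ∈ b.support := fun k hk => hL k (by simp [hk])
    set w := (L.map (Equiv.reflection P)).prod with hw
    rcases b.root_mem_or_neg_mem (w • i) with hpos | hneg'
    -- The reflection in αⱼ turns the positive root wαᵢ negative, and αⱼ is the only positive root
    -- with that property. Hence sⱼw = wsᵢ, and the letter j can be deleted.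
    · have hwi : w • i = j := by
        by_contra hne
        have h1 := reflection_mem_posMonoid b hpos hj hne
        rw [← Equiv.reflection_smul, ← root_smul] at h1
        refine neg_root_notMem b h1 ?_
        rw [root_smul, root_smul]
        rwa [List.map_cons, List.prod_cons, mul_smul] at hneg
      refine ⟨L, hL', by simp, ?_⟩
      have h2 := conj_reflection w i
      rw [hwi] at h2
      rw [List.map_cons, List.prod_cons, ← hw, ← h2]
      have h3 : Equiv.reflection P i * Equiv.reflection P i = 1 := by
        rw [mul_eq_one_iff_eq_inv, Equiv.reflection_inv]
      calc w = w * (Equiv.reflection P i * Equiv.reflection P i) := by rw [h3, mul_one]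
        _ = _ := by group
    · rw [root_smul] at hneg'
      obtain ⟨L', h1, h2, h3⟩ := ih hL' hneg'
      refine ⟨j :: L', ?_, by simpa using h2, ?_⟩
      · intro k hk
        rcases List.mem_cons.mp hk with rfl | hk
        exacts [hj, h1 k hk]
      · rw [List.map_cons, List.prod_cons, h3, List.map_cons, List.prod_cons, mul_assoc]

/-- An element of the Weyl group that preserves positivity is trivial. -/
theorem eq_one_of_smul_simple_mem {w : P.Aut} (hw : w ∈ P.weylGroup)
    (hpos : ∀ i ∈ b.support, w • P.root i ∈ posMonoid b) : w = 1 := by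
  obtain ⟨L, hL, rfl⟩ := exists_list_prod_eq b hw
  clear hw
  induction hn : L.length using Nat.strong_induction_on generalizing L with
  | _ n ih =>
    rcases List.eq_nil_or_concat L with rfl | ⟨L₁, i, rfl⟩
    · rfl
    · simp only [List.concat_eq_append, List.mem_append, List.mem_singleton, List.map_append,
        List.map_cons, List.map_nil, List.prod_append, List.prod_cons, List.prod_nil, mul_one,
        List.length_append, List.length_cons, List.length_nil] at *
      have hi : i ∈ b.support := hL i (Or.inr rfl)
      have h1 := hpos i hi
      rw [mul_smul, Equiv.reflection_smul, P.reflection_apply_self, smul_neg] at h1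
      -- With w = w₁sᵢ, positivity of wαᵢ = -w₁αᵢ lets exchange rewrite w as a word shorter than
      -- that of w₁.
      obtain ⟨L', h2, h3, h4⟩ := exists_exchange b L₁ (fun k hk => hL k (Or.inl hk)) hi h1
      rw [← h4]
      exact ih L'.length (by omega) L' h2 (by rwa [h4]) rfl

omit [Finite ι] [P.IsCrystallographic] [P.IsReduced] in
-- Take ρ to pair to 1 with every simple coroot, which the perfect pairing allows.
theorem exists_weyl_vector : ∃ ρ : V, ∀ i ∈ b.support, P.reflection i ρ = ρ - P.root i := by
  let φ : Module.Dual ℝ V' := b.toCoweightBasis.constr ℝ fun _ => (1 : ℝ)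
  obtain ⟨ρ, hρ⟩ := P.toPerfPair.surjective φ
  refine ⟨ρ, fun i hi => ?_⟩
  have : P.coroot' i ρ = 1 := by
    change P.toPerfPair ρ (P.coroot i) = 1
    rw [hρ, ← b.toCoweightBasis_apply ⟨i, hi⟩, Basis.constr_basis]
  rw [P.reflection_apply, this, one_smul]

omit [P.IsCrystallographic] [P.IsReduced] in
/-- Any automorphism of a root system is the product of an element of the Weyl group and an
automorphism preserving the base. -/
theorem exists_weyl_inv_mul_preserves (g : P.Aut) :
    ∃ w ∈ P.weylGroup, ∀ i, (w⁻¹ * g) • i ∈ b.support ↔ i ∈ b.support := by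
  obtain ⟨ρ, hρ⟩ := exists_weyl_vector b
  have : Finite P.Aut := aut_finite b
  obtain ⟨w, hw⟩ := Finite.exists_max fun w : P.weylGroup =>
    heightFunctional b (g⁻¹ • w.1 • ρ)
  refine ⟨w, w.2, ?_⟩
  have key : ∀ i ∈ b.support, (g⁻¹ * w.1) • P.root i ∈ posMonoid b := by
    intro i hi
    -- Comparing the maximizer w with wsᵢ, where sᵢρ = ρ - αᵢ, shows that g⁻¹wαᵢ has nonnegative
    -- height, hence is a positive root.
    have h1 := hw (w * ⟨_, P.reflection_mem_weylGroup i⟩)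
    simp only [Subgroup.coe_mul, mul_smul, Equiv.reflection_smul, hρ i hi, smul_sub, map_sub] at h1
    rw [← root_smul]
    refine (b.root_mem_or_neg_mem _).resolve_right fun h => ?_
    rcases one_le_heightFunctional b h with h2 | h2
    · exact P.ne_zero _ (neg_eq_zero.mp h2)
    · rw [map_neg, root_smul, mul_smul] at h2
      linarith
  intro i
  rw [← smul_mem_support_iff b key, ← mul_smul, mul_assoc, mul_inv_cancel_left, inv_mul_cancel,
    one_smul]

end Positivity

/-! ### Existence, uniqueness and sign properties of the highest root. -/

section Highest

variable {ι V V' : Type*} [AddCommGroup V] [Module ℝ V] [AddCommGroup V'] [Module ℝ V']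
  {P : RootPairing ι ℝ V V'} (b : P.Base)

theorem cast_pairingIn [P.IsCrystallographic] (i j : ι) :
    (P.pairingIn ℤ i j : ℝ) = P.pairing i j :=
  P.algebraMap_pairingIn ℤ i j

theorem exists_nat_coord [P.IsRootSystem] {m : V} (hm : m ∈ posMonoid b) (k : b.support) :
    ∃ n : ℕ, b.toWeightBasis.coord k m = n := by
  classical
  induction hm using AddSubmonoid.closure_induction with
  | mem x hx =>
    obtain ⟨i, hi, rfl⟩ := hx
    have := b.toWeightBasis_repr_root ⟨i, hi⟩
    simp only [Basis.coord_apply]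
    rw [this, Finsupp.single_apply]
    split_ifs
    exacts [⟨1, by simp⟩, ⟨0, by simp⟩]
  | zero => exact ⟨0, by simp⟩
  | add x y _ _ ihx ihy =>
    obtain ⟨m, hm⟩ := ihx
    obtain ⟨n, hn⟩ := ihy
    exact ⟨m + n, by rw [map_add, hm, hn]; push_cast; rfl⟩

theorem coord_nonneg [P.IsRootSystem] {m : V} (hm : m ∈ posMonoid b) (k : b.support) :
    0 ≤ b.toWeightBasis.coord k m := by
  obtain ⟨n, hn⟩ := exists_nat_coord b hm k
  rw [hn]
  exact n.cast_nonneg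

theorem pairing_eq_sum_coord [P.IsRootSystem] (i j : ι) :
    P.pairing i j = ∑ k : b.support, b.toWeightBasis.coord k (P.root i) * P.pairing k j := by
  rw [← P.root_coroot'_eq_pairing j i]
  conv_lhs => rw [← b.toWeightBasis.sum_repr (P.root i)]
  simp [map_sum]

/-- The root with index `j` is maximal: no other root exceeds it by a sum of simple roots. -/
def IsMaximal (j : ι) : Prop := ∀ k, P.root k - P.root j ∈ posMonoid b → k = j

theorem exists_isMaximal_ge [Finite ι] [P.IsRootSystem] (i : ι) :
    ∃ j, IsMaximal b j ∧ P.root j - P.root i ∈ posMonoid b := by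
  obtain ⟨j, hj, hmax⟩ := Set.exists_max_image {j | P.root j - P.root i ∈ posMonoid b}
    (fun j => heightFunctional b (P.root j)) (Set.toFinite _)
    ⟨i, by simp [zero_mem]⟩
  refine ⟨j, fun k hk => ?_, hj⟩
  have h1 : P.root k - P.root i ∈ posMonoid b := by simpa using add_mem hk hj
  have h2 := hmax k h1
  rcases one_le_heightFunctional b hk with h3 | h3
  · exact P.root.injective (sub_eq_zero.mp h3)
  · rw [map_sub] at h3
    linarith

variable {b} [P.IsRootSystem]

/-- If the root were negative, its opposite would exceed it by a sum of simple roots. -/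
theorem IsMaximal.root_mem {j : ι} (hj : IsMaximal b j) : P.root j ∈ posMonoid b := by
  refine (b.root_mem_or_neg_mem j).resolve_right fun h => ?_
  have h1 : P.root (P.reflectionPerm j j) = -P.root j := by
    rw [root_reflectionPerm, P.reflection_apply_self]
  have h2 := hj (P.reflectionPerm j j) (by
    rw [h1, sub_eq_add_neg]; exact add_mem h h)
  rw [h2] at h1
  have h3 : P.root j ∈ posMonoid b := by rw [h1]; exact h
  exact neg_root_notMem b h3 h

variable [Finite ι] [P.IsCrystallographic]

/-- Otherwise adding the simple root would give a larger root. -/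
theorem IsMaximal.pairingIn_nonneg {j k : ι} (hj : IsMaximal b j) (hk : k ∈ b.support) :
    0 ≤ P.pairingIn ℤ j k := by
  by_contra! h
  by_cases hjk : P.root j = -P.root k
  · have h1 := neg_root_notMem b hj.root_mem
    rw [hjk, neg_neg] at h1
    exact h1 (root_mem_posMonoid b hk)
  · obtain ⟨l, hl⟩ := P.root_add_root_mem_of_pairingIn_neg h hjk
    have h1 := hj l (by rw [hl, add_sub_cancel_left]; exact root_mem_posMonoid b hk)
    rw [h1] at hl
    exact P.ne_zero k (left_eq_add.mp hl)

/-- Positivity spreads along the connected Dynkin diagram: a vertex with zero coefficient next to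
one with positive coefficient would pair negatively with the maximal root. -/
theorem IsMaximal.coord_pos [P.IsReduced] [P.IsIrreducible] {j : ι} (hj : IsMaximal b j)
    (k : b.support) : 0 < b.toWeightBasis.coord k (P.root j) := by
  obtain ⟨i, hi⟩ : ∃ i, 0 < b.toWeightBasis.coord i (P.root j) := by
    by_contra! h
    refine P.ne_zero j (b.toWeightBasis.ext_elem fun i => ?_)
    rw [map_zero, Finsupp.zero_apply]
    exact le_antisymm (h i) (coord_nonneg b hj.root_mem i)
  refine b.induction_on_cartanMatrix (fun k => 0 < b.toWeightBasis.coord k (P.root j)) hi ?_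
  intro i k hi hik
  refine (coord_nonneg b hj.root_mem k).lt_of_ne fun h0 => ?_
  have h1 : P.pairing j k < 0 := by
    rw [pairing_eq_sum_coord b]
    have hneg (l : b.support) (hl : l ≠ k) : P.pairing l k ≤ 0 := by
      rw [← cast_pairingIn]
      exact_mod_cast b.cartanMatrix_le_zero_of_ne l k hl
    refine Finset.sum_neg' (fun l _ => ?_) ⟨i, Finset.mem_univ _, ?_⟩
    · by_cases hl : l = k
      · rw [hl, ← h0, zero_mul]
      · exact mul_nonpos_of_nonneg_of_nonpos (coord_nonneg b hj.root_mem l) (hneg l hl)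
    · have hne : i ≠ k := by
        rintro rfl
        exact hi.ne h0
      refine mul_neg_of_pos_of_neg hi ((hneg i hne).lt_of_ne fun h => hik ?_)
      rw [Base.cartanMatrix_apply_eq_zero_iff_symm, Base.cartanMatrix_apply_eq_zero_iff_pairing]
      exact h
  have h2 := hj.pairingIn_nonneg k.2
  rw [← cast_pairingIn] at h1
  exact h1.not_ge (by exact_mod_cast h2)

/-- One root has all coefficients positive and the other is dominant and nonzero, so they pair
positively. If they were distinct, their difference would be a root, and either sign contradicts
maximality of one of them. -/
theorem IsMaximal.eq [P.IsReduced] [P.IsIrreducible] {i j : ι} (hi : IsMaximal b i)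
    (hj : IsMaximal b j) : i = j := by
  by_contra hij
  have hnonneg (k : b.support) : 0 ≤ P.pairingIn ℤ k j := by
    have h1 := hj.pairingIn_nonneg k.2
    by_contra! h2
    exact h1.not_gt ((P.pairingIn_lt_zero_iff ℤ).mp h2)
  obtain ⟨k, hk, hk'⟩ := b.exists_mem_support_pos_pairingIn_ne_zero j
  have h1 : 0 < P.pairing i j := by
    rw [pairing_eq_sum_coord b]
    refine Finset.sum_pos' (fun l _ => mul_nonneg (hi.coord_pos l).le ?_)
      ⟨⟨k, hk⟩, Finset.mem_univ _, mul_pos (hi.coord_pos _) ?_⟩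
    · rw [← cast_pairingIn]
      exact_mod_cast hnonneg l
    · rw [← cast_pairingIn]
      exact_mod_cast (hnonneg ⟨k, hk⟩).lt_of_ne hk'.symm
  have h2 : 0 < P.pairingIn ℤ i j := by
    rw [← cast_pairingIn] at h1
    exact_mod_cast h1
  obtain ⟨l, hl⟩ := P.root_sub_root_mem_of_pairingIn_pos h2 hij
  rcases b.root_mem_or_neg_mem l with h | h
  · exact hij (hj i (by rwa [hl] at h))
  · exact hij (hi j (by rwa [hl, neg_sub] at h)).symm

omit [Finite ι] [P.IsCrystallographic] in
theorem IsHighest.isMaximal {h : ι} (hh : IsHighest b h) : IsMaximal b h := by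
  intro k hk
  refine P.root.injective (sub_eq_zero.mp (eq_zero_of_mem_of_neg_mem b hk ?_))
  rw [neg_sub]
  exact hh k

variable (b) in
/-- An irreducible root system has a highest root. -/
theorem exists_isHighest [P.IsReduced] [P.IsIrreducible] : ∃ h, IsHighest b h := by
  have : Nontrivial V := IsIrreducible.nontrivial P
  have : Nonempty ι := by
    by_contra hι
    rw [not_nonempty_iff] at hι
    have h1 := IsRootSystem.span_root_eq_top (P := P)
    rw [Set.range_eq_empty, Submodule.span_empty] at h1
    exact bot_ne_top h1
  obtain ⟨h, hh, -⟩ := exists_isMaximal_ge b (Classical.arbitrary ι)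
  refine ⟨h, fun i => ?_⟩
  obtain ⟨j, hj, hij⟩ := exists_isMaximal_ge b i
  rw [hj.eq hh] at hij
  exact hij

omit [Finite ι] [P.IsCrystallographic] in
theorem IsHighest.eq {h k : ι} (hh : IsHighest b h) (hk : IsHighest b k) : h = k := by
  refine P.root.injective (sub_eq_zero.mp (eq_zero_of_mem_of_neg_mem b (hh k) ?_))
  rw [neg_sub]
  exact hk h

omit [Finite ι] [P.IsCrystallographic] in
theorem IsLowest.eq {i j : ι} (hi : IsLowest b i) (hj : IsLowest b j) : i = j := by
  obtain ⟨h, hh, hi⟩ := hi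
  obtain ⟨k, hk, hj⟩ := hj
  exact P.root.injective (by rw [hi, hj, hh.eq hk])

variable (b) in
theorem exists_isLowest [P.IsReduced] [P.IsIrreducible] : ∃ i, IsLowest b i := by
  obtain ⟨h, hh⟩ := exists_isHighest b
  exact ⟨P.reflectionPerm h h, h, hh, by rw [root_reflectionPerm, P.reflection_apply_self]⟩

omit [Finite ι] [P.IsCrystallographic] in
theorem IsLowest.notMem_support {i : ι} (hi : IsLowest b i) : i ∉ b.support := by
  intro h
  obtain ⟨h, hh, hi⟩ := hi
  have h1 := neg_root_notMem b hh.isMaximal.root_mem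
  rw [← hi] at h1
  exact h1 (root_mem_posMonoid b ‹_›)

omit [P.IsRootSystem] [Finite ι] [P.IsCrystallographic] in
theorem IsLowest.smul {g : P.Aut} (hg : ∀ i, g • i ∈ b.support ↔ i ∈ b.support) {i : ι}
    (hi : IsLowest b i) : IsLowest b (g • i) := by
  obtain ⟨h, hh, hi⟩ := hi
  refine ⟨g • h, fun k => ?_, by rw [root_smul, root_smul, hi, smul_neg]⟩
  have h1 := smul_mem_posMonoid b (g := g)
    (fun i hi => by rw [← root_smul]; exact root_mem_posMonoid b ((hg i).mpr hi)) (hh (g⁻¹ • k))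
  rwa [smul_sub, ← root_smul, ← root_smul, smul_inv_smul] at h1

omit [P.IsRootSystem] [Finite ι] [P.IsCrystallographic] in
theorem isLowest_smul_iff {g : P.Aut} (hg : ∀ i, g • i ∈ b.support ↔ i ∈ b.support) (i : ι) :
    IsLowest b (g • i) ↔ IsLowest b i := by
  refine ⟨fun h => ?_, IsLowest.smul hg⟩
  have := IsLowest.smul (g := g⁻¹) (fun i => by rw [← hg, smul_inv_smul]) h
  rwa [inv_smul_smul] at this

/-- The highest root is dominant, so its opposite is at a non-acute angle with each simple root.
This fixes the signs that the diagram does not record. -/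
theorem pairingIn_nonpos_of_mem_extendedIdx {i j : ι} (hi : i ∈ extendedIdx b)
    (hj : j ∈ extendedIdx b) (hij : i ≠ j) : P.pairingIn ℤ i j ≤ 0 := by
  have key {i j : ι} (hi : IsLowest b i) (hj : j ∈ b.support) : P.pairingIn ℤ i j ≤ 0 := by
    obtain ⟨h, hh, hi⟩ := hi
    have h1 := hh.isMaximal.pairingIn_nonneg hj
    have h2 : P.pairing i j = -P.pairing h j := by
      rw [← P.root_coroot'_eq_pairing, ← P.root_coroot'_eq_pairing, hi, map_neg]
    rw [← cast_pairingIn, ← cast_pairingIn] at h2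
    have h3 : P.pairingIn ℤ i j = -P.pairingIn ℤ h j := by exact_mod_cast h2
    omega
  rcases hi with hi | hi <;> rcases hj with hj | hj
  · exact b.pairingIn_le_zero_of_ne hij hi hj
  · have h1 := key hj hi
    by_contra! h2
    exact h1.not_gt ((P.zero_lt_pairingIn_iff' ℤ).mp h2)
  · exact key hi hj
  · exact absurd (hi.eq hj) hij

end Highest

/-! ### Diagram automorphisms as restrictions of root system automorphisms. -/

section Restriction

variable {ι V V' : Type*} [AddCommGroup V] [Module ℝ V] [AddCommGroup V'] [Module ℝ V']
  (P : RootPairing ι ℝ V V')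

/-- The automorphisms of a root pairing that preserve a given set of roots. -/
def rootStabilizer (S : Set ι) : Subgroup P.Aut where
  carrier := {g | ∀ i, g • i ∈ S ↔ i ∈ S}
  mul_mem' := by
    intro g h hg hh i
    rw [mul_smul, hg, hh]
  one_mem' i := by rw [one_smul]
  inv_mem' := by
    intro g hg i
    rw [← hg, smul_inv_smul]

/-- The action on the diagram of `S` of the automorphisms that preserve `S`. -/
noncomputable def restrictAut [P.IsCrystallographic] (S : Set ι) :
    rootStabilizer P S →* (rootDiagram P S).aut where
  toFun g := ⟨(MulAction.toPerm g.1).subtypePerm g.2, by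
    refine ⟨fun i j => ?_, fun i j => ?_⟩
    · have h : (MulAction.toPerm g.1 : Equiv.Perm ι).subtypePerm g.2 i =
        (MulAction.toPerm g.1 : Equiv.Perm ι).subtypePerm g.2 j ↔ i = j :=
        (Equiv.injective _).eq_iff
      by_cases hij : i = j
      · simp [rootDiagram, hij]
      · simp only [rootDiagram, h, hij, if_false]
        exact congrArg Int.natAbs (congrArg₂ _ (pairingIn_smul_smul _ _ _)
          (pairingIn_smul_smul _ _ _))
    · change (P.pairingIn ℤ (g.1 • (j : ι)) (g.1 • (i : ι))).natAbs <
        (P.pairingIn ℤ (g.1 • (i : ι)) (g.1 • (j : ι))).natAbs ↔ _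
      rw [pairingIn_smul_smul, pairingIn_smul_smul]
      rfl⟩
  map_one' := by
    ext i
    exact one_smul P.Aut (i : ι)
  map_mul' g h := by
    ext i
    exact mul_smul g.1 h.1 (i : ι)

variable {P}

theorem exists_restrictAut_eq [P.IsCrystallographic] {S : Set ι} {g : P.Aut}
    {τ : (rootDiagram P S).aut} (h : ∀ i : S, g • (i : ι) = (τ : Equiv.Perm S) i) :
    ∃ g' : rootStabilizer P S, restrictAut P S g' = τ := by
  have hg : g ∈ rootStabilizer P S := by
    refine fun i => ⟨fun hi => ?_, fun hi => ?_⟩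
    · obtain ⟨k, hk⟩ := (τ : Equiv.Perm S).surjective ⟨_, hi⟩
      have h1 : g • (k : ι) = g • i := by rw [h, hk]
      rw [← MulAction.injective g h1]
      exact k.2
    · rw [h ⟨i, hi⟩]
      exact Subtype.coe_prop _
  refine ⟨⟨g, hg⟩, ?_⟩
  ext i
  exact h i

theorem restrictAut_injective [P.IsRootSystem] [P.IsCrystallographic] (b : P.Base) {S : Set ι}
    (hS : ∀ i ∈ b.support, i ∈ S) : Function.Injective (restrictAut P S) := by
  intro g h hgh
  refine Subtype.ext (aut_ext_of_support b fun i hi => ?_)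
  have := congrArg
    (fun τ : (rootDiagram P S).aut => (((τ : Equiv.Perm S) ⟨i, hS i hi⟩ : S) : ι)) hgh
  exact this

/-- A product of at most 4 and the order of its factors determine the factors: 4 = 2·2 and 4 = 1·4
are told apart by the arrow. The bound matters, since 1·6 = 2·3. -/
theorem eq_of_mul_eq_of_lt_iff {x y u v : ℕ} (hxy : x * y ≤ 4) (h : x * y = u * v)
    (h1 : x < y ↔ u < v) (h2 : y < x ↔ v < u) (h3 : x = 0 ↔ y = 0) (h4 : u = 0 ↔ v = 0) :
    x = u := by
  by_cases hx : x = 0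
  · have hy := h3.mp hx
    subst hx hy
    by_contra hu
    have hu' : 0 < u := Nat.pos_of_ne_zero (Ne.symm hu)
    have hv : 0 < v := Nat.pos_of_ne_zero fun hv => hu (h4.mpr hv).symm
    have := Nat.mul_pos hu' hv
    omega
  · have hx' : 0 < x := Nat.pos_of_ne_zero hx
    have hy' : 0 < y := Nat.pos_of_ne_zero fun hy => hx (h3.mpr hy)
    rcases lt_trichotomy x u with hxu | rfl | hxu
    · rcases Nat.lt_or_ge v y with hvy | hvy
      · have : y ≤ 4 := le_trans (Nat.le_mul_of_pos_left y hx') hxy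
        have : u ≤ 4 := by
          have hv : 0 < v := Nat.pos_of_ne_zero fun hv => by
            have := h4.mpr hv; omega
          exact le_trans (Nat.le_mul_of_pos_right u hv) (h ▸ hxy)
        interval_cases u <;> interval_cases x <;> omega
      · have := Nat.mul_lt_mul_of_lt_of_le hxu hvy (hy'.trans_le hvy)
        omega
    · rfl
    · rcases Nat.lt_or_ge y v with hvy | hvy
      · have : x ≤ 4 := le_trans (Nat.le_mul_of_pos_right x hy') hxy
        have hu : 0 < u := Nat.pos_of_ne_zero fun hu => by
          have := h4.mp hu; omega
        interval_cases x <;> interval_cases u <;> omega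
      · have := Nat.mul_lt_mul_of_lt_of_le hxu hvy hy'
        omega

/-- For roots at obtuse angles, the diagram determines the Cartan integers. -/
theorem pairing_apply_apply [Finite ι] [P.IsCrystallographic] {S : Set ι}
    (hS : ∀ i ∈ S, ∀ j ∈ S, i ≠ j → P.pairingIn ℤ i j ≤ 0) (τ : (rootDiagram P S).aut) (i j : S) :
    P.pairing ((τ : Equiv.Perm S) i) ((τ : Equiv.Perm S) j) = P.pairing i j := by
  by_cases hij : i = j
  · rw [hij, P.pairing_same, P.pairing_same]
  have hij' : (τ : Equiv.Perm S) i ≠ (τ : Equiv.Perm S) j := fun h => hij (Equiv.injective _ h)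
  have hb := τ.2.1 i j
  have ha := τ.2.2 i j
  have ha' := τ.2.2 j i
  simp only [rootDiagram, hij, hij', if_false, Int.natAbs_mul] at hb ha ha'
  have hzero (k l : ι) : (P.pairingIn ℤ k l).natAbs = 0 ↔ (P.pairingIn ℤ l k).natAbs = 0 := by
    rw [Int.natAbs_eq_zero, Int.natAbs_eq_zero, P.pairingIn_eq_zero_iff]
  have h4 : (P.pairingIn ℤ ((τ : Equiv.Perm S) i) ((τ : Equiv.Perm S) j)).natAbs *
      (P.pairingIn ℤ ((τ : Equiv.Perm S) j) ((τ : Equiv.Perm S) i)).natAbs ≤ 4 := by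
    rw [← Int.natAbs_mul]
    have h5 := P.coxeterWeightIn_mem_set_of_isCrystallographic ((τ : Equiv.Perm S) i)
      ((τ : Equiv.Perm S) j)
    simp only [coxeterWeightIn, mem_insert_iff, mem_singleton_iff] at h5
    omega
  have key := eq_of_mul_eq_of_lt_iff h4 hb ha' ha (hzero _ _) (hzero _ _)
  have n1 := hS _ i.2 _ j.2 fun h => hij (Subtype.ext h)
  have n2 := hS _ ((τ : Equiv.Perm S) i).2 _ ((τ : Equiv.Perm S) j).2 fun h => hij' (Subtype.ext h)
  rw [← cast_pairingIn, ← cast_pairingIn]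
  norm_cast
  omega

theorem restrictAut_simple_surjective [Finite ι] [P.IsRootSystem] [P.IsCrystallographic]
    [P.IsReduced] (b : P.Base) : Function.Surjective (restrictAut P (simpleIdx b)) := by
  intro θ
  obtain ⟨g, hg⟩ := exists_aut_of_pairing_eq b
    (fun i => ((θ : Equiv.Perm (simpleIdx b)) ⟨i, i.2⟩ : ι)) fun i j =>
      pairing_apply_apply (fun i hi j hj hij => b.pairingIn_le_zero_of_ne hij hi hj) θ
        ⟨i, i.2⟩ ⟨j, j.2⟩
  exact exists_restrictAut_eq fun i => hg ⟨i, i.2⟩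

end Restriction

/-! ### Marks, and surjectivity of restriction for the extended diagram. -/

section Marks

variable {ι V V' : Type*} [AddCommGroup V] [Module ℝ V] [AddCommGroup V'] [Module ℝ V']
  {P : RootPairing ι ℝ V V'} [P.IsRootSystem] (b : P.Base)

theorem sum_extendedIdx [Fintype (extendedIdx b)] {ℓ : ι} (hℓ : IsLowest b ℓ)
    (f : extendedIdx b → V) :
    ∑ i, f i = f ⟨ℓ, Or.inr hℓ⟩ + ∑ k : b.support, f ⟨k, Or.inl k.2⟩ := by
  classical
  let f' : ι → V := fun i => if hi : i ∈ extendedIdx b then f ⟨i, hi⟩ else 0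
  have hf' (i : extendedIdx b) : f' i = f i := dif_pos i.2
  have h1 : ∑ i ∈ insert ℓ b.support, f' i = ∑ i : extendedIdx b, f' i := by
    refine Finset.sum_subtype _ (fun i => ?_) f'
    rw [Finset.mem_insert, or_comm]
    exact or_congr_right ⟨fun h => h ▸ hℓ, fun h => h.eq hℓ⟩
  rw [Finset.sum_insert hℓ.notMem_support, ← Finset.sum_coe_sort] at h1
  simp only [hf'] at h1
  rw [← h1]
  congr 1
  · exact hf' ⟨ℓ, Or.inr hℓ⟩
  · exact Finset.sum_congr rfl fun k _ => hf' ⟨k, Or.inl k.2⟩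

open Classical in
/-- The marks of the extended Dynkin diagram: the coefficients of the root with index `h` at the
simple roots, and one elsewhere. -/
noncomputable def mark (h i : ι) : ℝ :=
  if hi : i ∈ b.support then b.toWeightBasis.coord ⟨i, hi⟩ (P.root h) else 1

theorem mark_simple (h : ι) (k : b.support) :
    mark b h k = b.toWeightBasis.coord k (P.root h) := dif_pos k.2

theorem mark_lowest (h : ι) {ℓ : ι} (hℓ : IsLowest b ℓ) : mark b h ℓ = 1 :=
  dif_neg hℓ.notMem_support

theorem exists_nat_mark {h : ι} (hh : IsHighest b h) (i : ι) : ∃ n : ℕ, mark b h i = n := by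
  by_cases hi : i ∈ b.support
  · rw [mark_simple b h ⟨i, hi⟩]
    exact exists_nat_coord b hh.isMaximal.root_mem _
  · exact ⟨1, by rw [mark, dif_neg hi]; simp⟩

variable [Fintype (extendedIdx b)]

theorem sum_mark_smul {h ℓ : ι} (hh : IsHighest b h) (hℓ : IsLowest b ℓ) :
    ∑ i : extendedIdx b, mark b h i • P.root i = 0 := by
  obtain ⟨h', hh', hroot⟩ := id hℓ
  rw [sum_extendedIdx b hℓ, mark_lowest b h hℓ, hroot, hh'.eq hh, one_smul]
  conv_lhs => rw [← b.toWeightBasis.sum_repr (P.root h)]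
  rw [neg_add_eq_zero]
  refine Finset.sum_congr rfl fun k _ => ?_
  rw [mark_simple, b.toWeightBasis_apply]
  rfl

/-- The marks span the linear relations between the vertices of the extended Dynkin diagram. -/
theorem eq_mul_mark_of_sum_eq_zero {h ℓ : ι} (hh : IsHighest b h) (hℓ : IsLowest b ℓ)
    {c : extendedIdx b → ℝ} (hc : ∑ i, c i • P.root i = 0) (i : extendedIdx b) :
    c i = c ⟨ℓ, Or.inr hℓ⟩ * mark b h i := by
  -- Subtracting this multiple of the mark relation kills the coefficient at -α₀ and leaves a
  -- relation between simple roots, which is trivial.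
  set d : extendedIdx b → ℝ := fun i => c i - c ⟨ℓ, Or.inr hℓ⟩ * mark b h i with hd
  have h1 : ∑ i, d i • P.root i = 0 := by
    simp only [hd, sub_smul, Finset.sum_sub_distrib, mul_smul, ← Finset.smul_sum]
    rw [hc, sum_mark_smul b hh hℓ, smul_zero, sub_zero]
  have h2 : d ⟨ℓ, Or.inr hℓ⟩ = 0 := by simp [hd, mark_lowest b h hℓ]
  rw [sum_extendedIdx b hℓ, h2, zero_smul, zero_add] at h1
  have h3 (k : b.support) : d ⟨k, Or.inl k.2⟩ = 0 := by
    refine Fintype.linearIndependent_iff.mp b.toWeightBasis.linearIndependent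
      (fun k => d ⟨k, Or.inl k.2⟩) ?_ k
    simpa using h1
  refine sub_eq_zero.mp (?_ : d i = 0)
  obtain ⟨i, hi | hi⟩ := i
  · exact h3 ⟨i, hi⟩
  · obtain rfl := hi.eq hℓ
    exact h2

/-- The permuted marks are a multiple of the marks, by the factor m = mark(σℓ). At σ⁻¹ℓ this reads 1
= m · mark(σ⁻¹ℓ) in natural numbers, so m = 1. -/
theorem mark_perm {h ℓ : ι} (hh : IsHighest b h) (hℓ : IsLowest b ℓ)
    (σ : Equiv.Perm (extendedIdx b))
    (hσ : ∑ i : extendedIdx b, mark b h (σ i) • P.root i = 0) (i : extendedIdx b) :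
    mark b h (σ i) = mark b h i := by
  have key := eq_mul_mark_of_sum_eq_zero b hh hℓ hσ
  obtain ⟨m, hm⟩ := exists_nat_mark b hh (σ ⟨ℓ, Or.inr hℓ⟩)
  obtain ⟨n, hn⟩ := exists_nat_mark b hh (σ.symm ⟨ℓ, Or.inr hℓ⟩)
  have h1 := key (σ.symm ⟨ℓ, Or.inr hℓ⟩)
  rw [σ.apply_symm_apply, mark_lowest b h hℓ, hm, hn] at h1
  have h2 : m = 1 := Nat.eq_one_of_mul_eq_one_right (by exact_mod_cast h1.symm)
  rw [key i, hm, h2, Nat.cast_one, one_mul]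

theorem mark_smul {h ℓ : ι} (hh : IsHighest b h) (hℓ : IsLowest b ℓ) {g : P.Aut}
    (hg : g ∈ rootStabilizer P (extendedIdx b)) {i : ι} (hi : i ∈ extendedIdx b) :
    mark b h (g • i) = mark b h i := by
  have hg' : ∀ i, MulAction.toPerm g i ∈ extendedIdx b ↔ i ∈ extendedIdx b := hg
  refine mark_perm b hh hℓ ((MulAction.toPerm g).subtypePerm hg') ?_ ⟨i, hi⟩
  refine MulAction.injective g ?_
  beta_reduce
  rw [smul_zero, Finset.smul_sum, ← sum_mark_smul b hh hℓ]
  refine Fintype.sum_equiv ((MulAction.toPerm g).subtypePerm hg') _ _ fun i => ?_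
  rw [smul_comm, ← root_smul]
  rfl

omit [Fintype (extendedIdx b)] in
theorem restrictAut_extended_surjective [Finite ι] [P.IsCrystallographic] [P.IsReduced]
    [P.IsIrreducible] : Function.Surjective (restrictAut P (extendedIdx b)) := by
  intro τ
  have := Fintype.ofFinite (extendedIdx b)
  have hpair := pairing_apply_apply
    (fun i hi j hj hij => pairingIn_nonpos_of_mem_extendedIdx (b := b) hi hj hij) τ
  obtain ⟨g, hg⟩ := exists_aut_of_pairing_eq b
    (fun i => ((τ : Equiv.Perm (extendedIdx b)) ⟨i, Or.inl i.2⟩ : ι)) fun i j =>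
      hpair ⟨i, Or.inl i.2⟩ ⟨j, Or.inl j.2⟩
  obtain ⟨h, hh⟩ := exists_isHighest b
  obtain ⟨ℓ, hℓ⟩ := exists_isLowest b
  have hsum := sum_mark_smul b hh hℓ
  -- As τ preserves Cartan integers, pairing the permuted sum with the coroot at j is the same as
  -- pairing the mark relation with the coroot at τ j, which gives zero.
  have hmark := mark_perm b hh hℓ τ (by
    rw [P.eq_zero_iff_forall_coroot'_eq_zero]
    have hz : P.toLinearMap (∑ i : extendedIdx b,
        mark b h ((τ : Equiv.Perm (extendedIdx b)) i) • P.root i) = 0 := by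
      refine b.toCoweightBasis.ext fun j => ?_
      rw [b.toCoweightBasis_apply, LinearMap.zero_apply]
      have h1 := congrArg (P.coroot' ((τ : Equiv.Perm (extendedIdx b)) ⟨j, Or.inl j.2⟩)) hsum
      rw [map_zero, map_sum] at h1
      change P.coroot' j (∑ i : extendedIdx b, _) = 0
      rw [map_sum, ← h1]
      refine Fintype.sum_equiv τ.1 _ _ fun i => ?_
      rw [map_smul, map_smul, root_coroot'_eq_pairing, root_coroot'_eq_pairing]
      exact congrArg _ (hpair i ⟨j, Or.inl j.2⟩).symm
    intro i
    exact LinearMap.congr_fun hz (P.coroot i))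
  have hlow : g • ℓ = (τ : Equiv.Perm (extendedIdx b)) ⟨ℓ, Or.inr hℓ⟩ := by
    have h1 : ∑ i : extendedIdx b,
        mark b h i • P.root ((τ : Equiv.Perm (extendedIdx b)) i) = 0 := by
      rw [← hsum]
      refine Fintype.sum_equiv τ.1 _ _ fun i => ?_
      rw [← hmark i]
    -- Both g(-α₀) and the root at τ(-α₀) are now minus the same combination of the roots at the
    -- images of the simple vertices.
    have h2 := congrArg (fun m => g • m) hsum
    rw [sum_extendedIdx b hℓ] at h1 h2
    rw [mark_lowest b h hℓ, one_smul] at h1 h2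
    simp only [smul_add, smul_zero, Finset.smul_sum] at h2
    refine smul_index_eq_of_root_eq ?_
    rw [eq_neg_of_add_eq_zero_left h1, eq_neg_of_add_eq_zero_left h2]
    congr 1
    refine Finset.sum_congr rfl fun k _ => ?_
    rw [smul_comm, ← root_smul, hg]
  refine exists_restrictAut_eq (g := g) ?_
  rintro ⟨i, hi | hi⟩
  · exact hg ⟨i, hi⟩
  · obtain rfl := hi.eq hℓ
    exact hlow

end Marks

/-! ### Weyl parts of affine transformations. -/

section AffineWeyl

variable {ι V V' : Type*} [AddCommGroup V] [Module ℝ V] [AddCommGroup V'] [Module ℝ V']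
  {P : RootPairing ι ℝ V V'}

theorem IsTranslateOf.translation_eq {f : V' ≃ᵃ[ℝ] V'} {v : V'} {w : P.weylGroup}
    (h : IsTranslateOf P f v w) : f 0 = v := by
  rw [h 0, map_zero, zero_add]

/-- The Weyl group acts faithfully on the coroot space, by the perfect pairing. Hence a Weyl part
picked by choice is still multiplicative. -/
theorem IsTranslateOf.weyl_unique {f : V' ≃ᵃ[ℝ] V'} {v v' : V'} {w w' : P.weylGroup}
    (h : IsTranslateOf P f v w) (h' : IsTranslateOf P f v' w') : w = w' := by
  have hv : v = v' := by rw [← h.translation_eq, h'.translation_eq]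
  rw [← inv_inj]
  refine Subtype.ext (aut_ext fun m => P.toPerfPair.injective (LinearMap.ext fun x => ?_))
  have h1 : coweightAction P w x = coweightAction P w' x := by
    have h2 := h x
    rw [h' x, hv] at h2
    exact (add_right_cancel h2).symm
  have h2 := congrArg (P.toLinearMap m) h1
  rwa [toLinearMap_coweightAction, toLinearMap_coweightAction] at h2

theorem IsTranslateOf.mul {f g : V' ≃ᵃ[ℝ] V'} {v v' : V'} {w w' : P.weylGroup}
    (hf : IsTranslateOf P f v w) (hg : IsTranslateOf P g v' w') :
    IsTranslateOf P (f * g) (coweightAction P w v' + v) (w * w') := fun x => by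
  rw [AffineEquiv.coe_mul, Function.comp_apply, hf, hg, map_add, map_mul, LinearEquiv.mul_apply,
    add_assoc]

theorem IsTranslateOf.toLinearMap_apply {f : V' ≃ᵃ[ℝ] V'} {v : V'} {w : P.weylGroup}
    (h : IsTranslateOf P f v w) (m : V) (x : V') :
    P.toLinearMap m (f x) = P.toLinearMap ((w : P.Aut)⁻¹ • m) x + P.toLinearMap m v := by
  rw [h x, map_add, toLinearMap_coweightAction]
  rfl

/-- The Weyl part of an element of `Ω`. -/
noncomputable def omegaWeyl (b : P.Base) : Omega b →* P.weylGroup where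
  toFun ω := ω.2.1.choose_spec.2.choose
  map_one' := (Exists.choose_spec (1 : Omega b).2.1.choose_spec.2).weyl_unique
    (v' := 0) (w' := 1) fun x => by simp
  map_mul' ω ω' := (Exists.choose_spec (ω * ω').2.1.choose_spec.2).weyl_unique
    ((Exists.choose_spec ω.2.1.choose_spec.2).mul (Exists.choose_spec ω'.2.1.choose_spec.2))

theorem exists_isTranslateOf_omegaWeyl (b : P.Base) (ω : Omega b) :
    ∃ v ∈ coweightLattice P, IsTranslateOf P (ω : V' ≃ᵃ[ℝ] V') v (omegaWeyl b ω) :=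
  ⟨_, ω.2.1.choose_spec.1, ω.2.1.choose_spec.2.choose_spec⟩

theorem omegaWeyl_eq (b : P.Base) {ω : Omega b} {v : V'} {w : P.weylGroup}
    (h : IsTranslateOf P (ω : V' ≃ᵃ[ℝ] V') v w) : omegaWeyl b ω = w := by
  obtain ⟨v', -, h'⟩ := exists_isTranslateOf_omegaWeyl b ω
  exact h'.weyl_unique h

end AffineWeyl

/-! ### The alcove, simple affine roots, and Ω as W ∩ Stab(Π̂). -/

section Alcove

variable {ι V V' : Type*} [AddCommGroup V] [Module ℝ V] [AddCommGroup V'] [Module ℝ V']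
  {P : RootPairing ι ℝ V V'} (b : P.Base)

open Classical in
/-- The constant term of the affine root attached to a vertex of the extended Dynkin diagram. -/
noncomputable def affineShift (i : ι) : ℝ := if IsLowest b i then 1 else 0

variable {b} in
theorem affineShift_lowest {i : ι} (hi : IsLowest b i) : affineShift b i = 1 := if_pos hi

theorem exists_coweight_apply_eq (φ : V →ₗ[ℝ] ℝ) : ∃ x : V', ∀ m, P.toLinearMap m x = φ m := by
  obtain ⟨x, hx⟩ := P.flip.toPerfPair.surjective φ
  exact ⟨x, fun m => LinearMap.congr_fun hx m⟩

theorem toLinearMap_nonneg_of_mem_posMonoid {x : V'}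
    (hx : ∀ i ∈ b.support, 0 ≤ P.toLinearMap (P.root i) x) {m : V} (hm : m ∈ posMonoid b) :
    0 ≤ P.toLinearMap m x := by
  induction hm using AddSubmonoid.closure_induction with
  | mem y hy => obtain ⟨i, hi, rfl⟩ := hy; exact hx i hi
  | zero => simp
  | add y z _ _ ihy ihz => rw [map_add]; exact add_nonneg ihy ihz

theorem zero_mem_fundamentalAlcove : (0 : V') ∈ fundamentalAlcove b := fun i _ => by simp

variable [P.IsRootSystem]

variable {b} in
theorem affineShift_simple {i : ι} (hi : i ∈ b.support) : affineShift b i = 0 :=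
  if_neg fun h => h.notMem_support hi

variable {b} in
theorem mem_fundamentalAlcove_iff {h : ι} (hh : IsHighest b h) (x : V') :
    x ∈ fundamentalAlcove b ↔ (∀ i ∈ b.support, 0 ≤ P.toLinearMap (P.root i) x) ∧
      P.toLinearMap (P.root h) x ≤ 1 := by
  refine ⟨fun hx => ⟨fun i hi => (hx i (root_mem_posMonoid b hi)).1,
    (hx h hh.isMaximal.root_mem).2⟩, fun ⟨hx, hx'⟩ i hi => ?_⟩
  refine ⟨toLinearMap_nonneg_of_mem_posMonoid b hx hi, ?_⟩
  have := toLinearMap_nonneg_of_mem_posMonoid b hx (hh i)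
  rw [map_sub, LinearMap.sub_apply] at this
  linarith

variable {b} in
-- All walls take one form, indexed by the extended vertices, so that a symmetry of the alcove can
-- be read as a permutation of them.
theorem mem_fundamentalAlcove_iff_extended {ℓ : ι} (hℓ : IsLowest b ℓ) (x : V') :
    x ∈ fundamentalAlcove b ↔
      ∀ i ∈ extendedIdx b, 0 ≤ P.toLinearMap (P.root i) x + affineShift b i := by
  obtain ⟨h, hh, hroot⟩ := id hℓ
  have hlow : 0 ≤ P.toLinearMap (P.root ℓ) x + affineShift b ℓ ↔
      P.toLinearMap (P.root h) x ≤ 1 := by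
    rw [affineShift_lowest hℓ, hroot, map_neg, LinearMap.neg_apply, neg_add_eq_sub, sub_nonneg]
  rw [mem_fundamentalAlcove_iff hh, ← hlow]
  refine ⟨fun ⟨hx, hx'⟩ i hi => ?_, fun hx => ⟨fun i hi => ?_, hx ℓ (Or.inr hℓ)⟩⟩
  · rcases hi with hi | hi
    · rw [affineShift_simple hi, add_zero]
      exact hx i hi
    · rwa [hi.eq hℓ]
  · simpa [affineShift_simple hi] using hx i (Or.inl hi)

/-- The simple affine roots, as pairs of a linear part and a constant term. -/
def simpleAffineRoots : Set (V × ℝ) :=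
  {p | ∃ i ∈ extendedIdx b, p = (P.root i, affineShift b i)}

theorem mk_zero_mem_closure {m : V} (hm : m ∈ posMonoid b) :
    (m, (0 : ℝ)) ∈ AddSubmonoid.closure (simpleAffineRoots b) := by
  induction hm using AddSubmonoid.closure_induction with
  | mem x hx =>
    obtain ⟨i, hi, rfl⟩ := hx
    exact AddSubmonoid.subset_closure ⟨i, Or.inl hi, by rw [affineShift_simple hi]⟩
  | zero => exact zero_mem _
  | add x y _ _ ihx ihy =>
    have := add_mem ihx ihy
    rwa [Prod.mk_add_mk, add_zero] at this

/-- The affine roots that are nonnegative on the fundamental alcove are sums of simple affine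
roots. -/
theorem mem_closure_simpleAffineRoots {ℓ : ι} (hℓ : IsLowest b ℓ) {i : ι} {n : ℤ}
    (hn : ∀ x ∈ fundamentalAlcove b, 0 ≤ P.toLinearMap (P.root i) x + n) :
    (P.root i, (n : ℝ)) ∈ AddSubmonoid.closure (simpleAffineRoots b) := by
  obtain ⟨h, hh, hroot⟩ := id hℓ
  have hlow : (-P.root h, (1 : ℝ)) ∈ AddSubmonoid.closure (simpleAffineRoots b) :=
    AddSubmonoid.subset_closure ⟨ℓ, Or.inr hℓ, by rw [hroot, affineShift_lowest hℓ]⟩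
  have hone : ((0 : V), (1 : ℝ)) ∈ AddSubmonoid.closure (simpleAffineRoots b) := by
    simpa using add_mem (mk_zero_mem_closure b hh.isMaximal.root_mem) hlow
  have hnat (k : ℕ) : ((0 : V), (k : ℝ)) ∈ AddSubmonoid.closure (simpleAffineRoots b) := by
    simpa using nsmul_mem hone k
  have hpos := one_le_heightFunctional b hh.isMaximal.root_mem
  rcases b.root_mem_or_neg_mem i with hi | hi
  · have h0 := hn 0 (zero_mem_fundamentalAlcove b)
    rw [map_zero, zero_add] at h0
    lift n to ℕ using (by exact_mod_cast h0)
    simpa using add_mem (mk_zero_mem_closure b hi) (hnat n)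
  · have hH := hpos.resolve_left (P.ne_zero h)
    -- The test point is the alcove point where every root takes the value of its height divided by
    -- that of α₀. A negative root is strictly negative there, which forces n > 0.
    obtain ⟨x, hx⟩ := exists_coweight_apply_eq (P := P)
      ((heightFunctional b (P.root h))⁻¹ • heightFunctional b)
    have hxA : x ∈ fundamentalAlcove b := by
      refine (mem_fundamentalAlcove_iff hh x).mpr ⟨fun j hj => ?_, ?_⟩
      · rw [hx, LinearMap.smul_apply, heightFunctional_root b hj, smul_eq_mul, mul_one]
        positivity
      · rw [hx, LinearMap.smul_apply, smul_eq_mul, inv_mul_cancel₀ (by linarith)]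
    have h1 := hn x hxA
    have h2 : heightFunctional b (P.root i) < 0 := by
      have h3 := (one_le_heightFunctional b hi).resolve_left (neg_ne_zero.mpr (P.ne_zero i))
      rw [map_neg] at h3
      linarith
    have h3 : (heightFunctional b (P.root h))⁻¹ * heightFunctional b (P.root i) < 0 :=
      mul_neg_of_pos_of_neg (by positivity) h2
    rw [hx, LinearMap.smul_apply, smul_eq_mul] at h1
    have h4 : (0 : ℝ) < n := by linarith
    -- With n = k + 1, split (α, n) = (α₀ + α, 0) + (-α₀, 1) + (0, k). The first term is a sum of
    -- simple roots because α₀ dominates -α.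
    obtain ⟨k, rfl⟩ : ∃ k : ℕ, n = k + 1 :=
      ⟨(n - 1).toNat, by have : 0 < n := by exact_mod_cast h4
                         omega⟩
    have h5 : P.root h + P.root i ∈ posMonoid b := by
      have := hh (P.reflectionPerm i i)
      rwa [root_reflectionPerm, P.reflection_apply_self, sub_neg_eq_add] at this
    have h6 := add_mem (add_mem (mk_zero_mem_closure b h5) hlow) (hnat k)
    convert h6 using 1
    ext
    · simp
    · simp [add_comm]

omit [P.IsRootSystem] in
theorem mem_rootStabilizer_of_forall_mem [Finite ι] {S : Set ι} {g : P.Aut}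
    (hg : ∀ i ∈ S, g • i ∈ S) : g ∈ rootStabilizer P S := by
  intro i
  refine ⟨fun hi => ?_, hg i⟩
  have himage : (fun i => g • i) '' S = S :=
    Set.eq_of_subset_of_ncard_le (by rintro _ ⟨i, hi, rfl⟩; exact hg i hi)
      (Set.ncard_image_of_injective S (MulAction.injective g)).ge
  rw [← himage] at hi
  obtain ⟨j, hj, hji⟩ := hi
  rwa [← MulAction.injective g hji]

/-- The Weyl part of an affine transformation that preserves the fundamental alcove permutes the
vertices of the extended Dynkin diagram. -/
theorem IsTranslateOf.weyl_mem_rootStabilizer [Finite ι] {ℓ : ι} (hℓ : IsLowest b ℓ)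
    {f : V' ≃ᵃ[ℝ] V'} {v : V'} (hv : v ∈ coweightLattice P) {w : P.weylGroup}
    (hf : IsTranslateOf P f v w) (hA : f '' fundamentalAlcove b = fundamentalAlcove b) :
    (w : P.Aut) ∈ rootStabilizer P (extendedIdx b) := by
  obtain ⟨h, hh, hroot⟩ := id hℓ
  have hint (i : ι) : ∃ n : ℤ, affineShift b i = n := by
    rw [affineShift]
    split_ifs
    exacts [⟨1, by simp⟩, ⟨0, by simp⟩]
  -- A pair (m, c) stands for the affine function x ↦ ⟨m, x⟩ + c, and T is composition with f⁻¹.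
  let T : V × ℝ ≃+ V × ℝ :=
    { toFun := fun p => ((w : P.Aut) • p.1, p.2 - P.toLinearMap ((w : P.Aut) • p.1) v)
      invFun := fun p => ((w : P.Aut)⁻¹ • p.1, p.2 + P.toLinearMap p.1 v)
      left_inv := fun p => by ext <;> simp
      right_inv := fun p => by ext <;> simp
      map_add' := fun p q => by
        ext
        · simp
        · simp only [Prod.fst_add, Prod.snd_add, smul_add, map_add, LinearMap.add_apply]
          ring }
  -- The constant term is weighted by ht(α₀) + 1 so that (-α₀, 1) has height one, like the simple
  -- roots.
  let H : V × ℝ →+ ℝ :=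
    { toFun := fun p => heightFunctional b p.1 + p.2 * (heightFunctional b (P.root h) + 1)
      map_zero' := by simp
      map_add' := fun p q => by
        simp only [Prod.fst_add, Prod.snd_add, map_add]
        ring }
  refine mem_rootStabilizer_of_forall_mem fun i hi => ?_
  have hmem : T (P.root i, affineShift b i) ∈ simpleAffineRoots b := by
    refine apply_mem_of_mem_closure (simpleAffineRoots b) T H ?_ ?_ ?_ ⟨i, hi, rfl⟩
    · rintro _ ⟨i, hi | hi, rfl⟩
      · simp [H, affineShift_simple hi, heightFunctional_root b hi]
      · obtain rfl := hi.eq hℓ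
        simp [H, affineShift_lowest hi, hroot]
    · rintro _ ⟨i, hi, rfl⟩
      obtain ⟨m, hm⟩ := hint i
      obtain ⟨n, hn⟩ := hv ((w : P.Aut) • i)
      have hT : T (P.root i, affineShift b i) =
          (P.root ((w : P.Aut) • i), ((m - n : ℤ) : ℝ)) := by
        push_cast
        rw [← hm, ← hn, root_smul]
        rfl
      rw [hT]
      refine mem_closure_simpleAffineRoots b hℓ fun x hx => ?_
      rw [← hA] at hx
      obtain ⟨y, hy, rfl⟩ := hx
      have h1 := (mem_fundamentalAlcove_iff_extended hℓ y).mp hy i hi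
      rw [hf.toLinearMap_apply, ← root_smul, inv_smul_smul]
      push_cast
      rw [← hm, ← hn]
      linarith
    · rintro _ ⟨i, hi, rfl⟩
      obtain ⟨m, hm⟩ := hint i
      obtain ⟨n, hn⟩ := hv i
      have hT : T.symm (P.root i, affineShift b i) =
          (P.root ((w : P.Aut)⁻¹ • i), ((m + n : ℤ) : ℝ)) := by
        push_cast
        rw [← hm, ← hn, root_smul]
        rfl
      rw [hT]
      refine mem_closure_simpleAffineRoots b hℓ fun x hx => ?_
      have hfx : f x ∈ fundamentalAlcove b := hA ▸ ⟨x, hx, rfl⟩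
      have h1 := (mem_fundamentalAlcove_iff_extended hℓ _).mp hfx i hi
      rw [hf.toLinearMap_apply, ← root_smul] at h1
      push_cast
      rw [← hm, ← hn]
      linarith
  obtain ⟨j, hj, hij⟩ := hmem
  rwa [smul_index_eq_of_root_eq (congrArg Prod.fst hij : (w : P.Aut) • P.root i = P.root j)]

theorem exists_int_coord (k : b.support) (i : ι) :
    ∃ n : ℤ, b.toWeightBasis.coord k (P.root i) = n := by
  rcases b.root_mem_or_neg_mem i with hi | hi
  · obtain ⟨n, hn⟩ := exists_nat_coord b hi k
    exact ⟨n, by rw [hn]; simp⟩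
  · obtain ⟨n, hn⟩ := exists_nat_coord b hi k
    refine ⟨-n, ?_⟩
    rw [map_neg, neg_eq_iff_eq_neg] at hn
    rw [hn]
    simp

/-- For an automorphism permuting the vertices of the extended Dynkin diagram, there is a coweight
whose translation realizes the induced permutation of the constant terms of the affine roots. -/
theorem exists_coweight_affineShift [Finite ι] {ℓ : ι} (hℓ : IsLowest b ℓ) {g : P.Aut}
    (hg : g ∈ rootStabilizer P (extendedIdx b)) :
    ∃ v ∈ coweightLattice P, ∀ i ∈ extendedIdx b,
      P.toLinearMap (P.root i) v = affineShift b (g⁻¹ • i) - affineShift b i := by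
  classical
  have := Fintype.ofFinite (extendedIdx b)
  have hlow (i : ι) : affineShift b (g⁻¹ • i) = if i = g • ℓ then 1 else 0 := by
    rw [affineShift]
    congr 1
    rw [eq_iff_iff, ← inv_smul_eq_iff]
    exact ⟨fun h => h.eq hℓ, fun h => h ▸ hℓ⟩
  rcases (hg ℓ).mpr (Or.inr hℓ) with hk | hk
  · obtain ⟨v, hv⟩ := exists_coweight_apply_eq (P := P) (b.toWeightBasis.coord ⟨g • ℓ, hk⟩)
    refine ⟨v, fun i => ?_, fun i hi => ?_⟩
    · obtain ⟨n, hn⟩ := exists_int_coord b ⟨g • ℓ, hk⟩ i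
      exact ⟨n, by rw [hv, hn]⟩
    · rw [hv, hlow]
      rcases hi with hi | hi
      · rw [affineShift_simple hi, sub_zero, Basis.coord_apply]
        have := b.toWeightBasis_repr_root ⟨i, hi⟩
        rw [this, Finsupp.single_apply]
        simp
      · obtain rfl := hi.eq hℓ
        obtain ⟨h, hh, hroot⟩ := id hℓ
        -- At -α₀ the required value is -1, whereas v gives minus the mark of g(-α₀). That mark is 1
        -- by invariance.
        have hne : i ≠ g • i := fun h => hi.notMem_support (h ▸ hk)
        rw [affineShift_lowest hi, if_neg hne, hroot, map_neg,
          ← mark_simple b h ⟨g • i, hk⟩, mark_smul b hh hℓ hg (Or.inr hi), mark_lowest b h hi]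
        simp
  · refine ⟨0, zero_mem _, fun i _ => ?_⟩
    rw [map_zero, hlow, hk.eq hℓ, affineShift]
    have : IsLowest b i ↔ i = ℓ := ⟨fun h => h.eq hℓ, fun h => h ▸ hℓ⟩
    simp [this]

theorem exists_omegaWeyl_eq [Finite ι] {ℓ : ι} (hℓ : IsLowest b ℓ) (w : P.weylGroup)
    (hw : (w : P.Aut) ∈ rootStabilizer P (extendedIdx b)) : ∃ ω, omegaWeyl b ω = w := by
  obtain ⟨v, hv, hvw⟩ := exists_coweight_affineShift b hℓ hw
  let f : V' ≃ᵃ[ℝ] V' := (coweightAction P w).toAffineEquiv.trans (AffineEquiv.constVAdd ℝ V' v)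
  have hf : IsTranslateOf P f v w := fun x => add_comm _ _
  have hmem (x : V') : f x ∈ fundamentalAlcove b ↔ x ∈ fundamentalAlcove b := by
    rw [mem_fundamentalAlcove_iff_extended hℓ, mem_fundamentalAlcove_iff_extended hℓ]
    have key (i : ι) (hi : i ∈ extendedIdx b) :
        P.toLinearMap (P.root i) (f x) + affineShift b i =
          P.toLinearMap (P.root ((w : P.Aut)⁻¹ • i)) x + affineShift b ((w : P.Aut)⁻¹ • i) := by
      rw [hf.toLinearMap_apply, hvw i hi, root_smul]
      ring
    refine ⟨fun h i hi => ?_, fun h i hi => ?_⟩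
    · have h1 := h _ ((hw i).mpr hi)
      rwa [key _ ((hw i).mpr hi), inv_smul_smul] at h1
    · rw [key i hi]
      exact h _ ((inv_mem hw i).mpr hi)
  have himage : f '' fundamentalAlcove b = fundamentalAlcove b := by
    ext x
    refine ⟨?_, fun hx => ⟨f.symm x, ?_, f.apply_symm_apply x⟩⟩
    · rintro ⟨y, hy, rfl⟩
      exact (hmem y).mpr hy
    · rwa [← hmem, f.apply_symm_apply]
  exact ⟨⟨f, ⟨v, hv, w, hf⟩, himage⟩, omegaWeyl_eq b hf⟩

/-- An element of the kernel is a translation by some v preserving the alcove. As 0 lies in the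
alcove, so do v and -v, so every simple root vanishes on v. -/
theorem omegaWeyl_injective : Function.Injective (omegaWeyl b) := by
  rw [injective_iff_map_eq_one]
  intro ω hω
  obtain ⟨v, -, hv⟩ := exists_isTranslateOf_omegaWeyl b ω
  rw [hω] at hv
  have hfx (x : V') : (ω : V' ≃ᵃ[ℝ] V') x = x + v := by
    rw [hv x, map_one]
    rfl
  have hA := ω.2.2
  have h0 : v ∈ fundamentalAlcove b := by
    rw [← hA]
    exact ⟨0, zero_mem_fundamentalAlcove b, by rw [hfx, zero_add]⟩
  obtain ⟨x, hx, hx0⟩ : (0 : V') ∈ (ω : V' ≃ᵃ[ℝ] V') '' fundamentalAlcove b := by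
    rw [hA]
    exact zero_mem_fundamentalAlcove b
  rw [hfx] at hx0
  obtain rfl := eq_neg_of_add_eq_zero_left hx0
  have hv0 : P.flip.toPerfPair v = 0 := by
    refine b.toWeightBasis.ext fun i => ?_
    rw [b.toWeightBasis_apply, LinearMap.zero_apply]
    change P.toLinearMap (P.root i) v = 0
    have h1 := (h0 i (root_mem_posMonoid b i.2)).1
    have h2 := (hx i (root_mem_posMonoid b i.2)).1
    rw [map_neg] at h2
    linarith
  have hv1 : v = 0 := P.flip.toPerfPair.injective (by rw [hv0, map_zero])
  refine Subtype.ext (AffineEquiv.ext fun x => ?_)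
  rw [hfx, hv1, add_zero]
  rfl

end Alcove

/-- The internal description of semidirect products, for a normal subgroup and a complement given as
the images of injective homomorphisms. -/
theorem exists_semidirectProduct_mulEquiv {N H G : Type*} [Group N] [Group H] [Group G]
    (ρ : N →* G) (hρ : Function.Injective ρ) [ρ.range.Normal] (e : H →* G)
    (hdisj : ∀ n h, ρ n = e h → h = 1) (hsurj : ∀ g, ∃ n h, g = ρ n * e h) :
    Function.Bijective ((QuotientGroup.mk' ρ.range).comp e) ∧
      ∃ φ : H →* MulAut N, ∃ Ψ : (N ⋊[φ] H) ≃* G, ∀ n h, Ψ ⟨n, h⟩ = ρ n * e h := by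
  refine ⟨⟨?_, ?_⟩, ?_⟩
  · rw [injective_iff_map_eq_one]
    intro h hh
    obtain ⟨n, hn⟩ := (QuotientGroup.eq_one_iff (e h)).mp hh
    exact hdisj n h hn
  · intro q
    obtain ⟨g, rfl⟩ := QuotientGroup.mk'_surjective _ q
    obtain ⟨n, h, rfl⟩ := hsurj g
    refine ⟨h, ?_⟩
    have hn : QuotientGroup.mk' ρ.range (ρ n) = 1 :=
      (QuotientGroup.eq_one_iff (ρ n)).mpr (MonoidHom.mem_range.mpr ⟨n, rfl⟩)
    rw [map_mul, hn, one_mul]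
    rfl
  · let φ : H →* MulAut N := (MulAut.congr (ρ.ofInjective hρ)).symm.toMonoidHom.comp
      (MulAut.conjNormal.comp e)
    have hφ (h : H) (n : N) : ρ (φ h n) = e h * ρ n * (e h)⁻¹ := by
      have h1 : ρ.ofInjective hρ (φ h n) = MulAut.conjNormal (e h) (ρ.ofInjective hρ n) := by
        simp [φ, MulAut.congr]
      exact congrArg Subtype.val h1
    let Ψ : (N ⋊[φ] H) →* G := SemidirectProduct.lift ρ e fun h => MonoidHom.ext fun n => hφ h n
    have hΨ (n : N) (h : H) : Ψ ⟨n, h⟩ = ρ n * e h := rfl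
    refine ⟨φ, MulEquiv.ofBijective Ψ ⟨?_, fun g => ?_⟩, hΨ⟩
    · rw [injective_iff_map_eq_one]
      rintro ⟨n, h⟩ hnh
      rw [hΨ] at hnh
      obtain rfl := hdisj n⁻¹ h (by rw [map_inv, eq_comm]; exact eq_inv_of_mul_eq_one_right hnh)
      rw [map_one, mul_one] at hnh
      rw [hρ (hnh.trans (map_one ρ).symm)]
      rfl
    · obtain ⟨n, h, rfl⟩ := hsurj g
      exact ⟨⟨n, h⟩, rfl⟩

/-! ### Assembling Ω, Aut(D) and Aut(D̂). -/

section Main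

variable {ι V V' : Type*} [Finite ι] [AddCommGroup V] [Module ℝ V] [AddCommGroup V'] [Module ℝ V']
  {P : RootPairing ι ℝ V V'} [P.IsRootSystem] [P.IsCrystallographic] [P.IsReduced]
  [P.IsIrreducible] (b : P.Base)

omit [Finite ι] [P.IsRootSystem] [P.IsCrystallographic] [P.IsReduced] [P.IsIrreducible] in
theorem rootStabilizer_simpleIdx_le :
    rootStabilizer P (simpleIdx b) ≤ rootStabilizer P (extendedIdx b) :=
  fun _ hg i => or_congr (hg i) (isLowest_smul_iff hg i)

/-- The homomorphism from `Ω` to the automorphisms preserving the extended base. -/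
noncomputable def omegaToStabilizer : Omega b →* rootStabilizer P (extendedIdx b) :=
  (P.weylGroup.subtype.comp (omegaWeyl b)).codRestrict _ fun ω => by
    obtain ⟨ℓ, hℓ⟩ := exists_isLowest b
    obtain ⟨v, hv, h⟩ := exists_isTranslateOf_omegaWeyl b ω
    exact h.weyl_mem_rootStabilizer b hℓ hv ω.2.2

/-- The action of `Ω` on the extended Dynkin diagram. -/
noncomputable def omegaAction : Omega b →* (extendedDynkin b).aut :=
  (restrictAut P (extendedIdx b)).comp (omegaToStabilizer b)

omit [Finite ι] [P.IsReduced] [P.IsIrreducible] in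
theorem restrictAut_extended_injective : Function.Injective (restrictAut P (extendedIdx b)) :=
  restrictAut_injective b fun _ hi => Or.inl hi

theorem omegaAction_injective : Function.Injective (omegaAction b) := by
  refine (restrictAut_extended_injective b).comp fun ω ω' h => omegaWeyl_injective b ?_
  exact Subtype.ext (congrArg (fun g : rootStabilizer P (extendedIdx b) => (g : P.Aut)) h)

theorem restrictAut_mem_range_omegaAction {g : rootStabilizer P (extendedIdx b)}
    (hg : (g : P.Aut) ∈ P.weylGroup) : restrictAut P (extendedIdx b) g ∈ (omegaAction b).range := by
  obtain ⟨ℓ, hℓ⟩ := exists_isLowest b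
  obtain ⟨ω, hω⟩ := exists_omegaWeyl_eq b hℓ ⟨g, hg⟩ g.2
  refine ⟨ω, congrArg (restrictAut P (extendedIdx b)) (Subtype.ext ?_)⟩
  exact congrArg (fun w : P.weylGroup => (w : P.Aut)) hω

/-- Every automorphism of the extended diagram lifts to `P.Aut`, where W is normal. -/
theorem omegaAction_range_normal : (omegaAction b).range.Normal := by
  refine ⟨?_⟩
  rintro _ ⟨ω, rfl⟩ τ
  obtain ⟨g, rfl⟩ := restrictAut_extended_surjective b τ
  have := restrictAut_mem_range_omegaAction b (g := g * omegaToStabilizer b ω * g⁻¹)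
    (weylGroup_normal.conj_mem _ (omegaWeyl b ω).2 _)
  rwa [map_mul, map_mul, map_inv] at this

/-- The automorphisms of the Dynkin diagram are the automorphisms of the root system that preserve
the base. -/
noncomputable def simpleAutEquiv : rootStabilizer P (simpleIdx b) ≃* (dynkin b).aut :=
  MulEquiv.ofBijective (restrictAut P (simpleIdx b))
    ⟨restrictAut_injective b fun _ hi => hi, restrictAut_simple_surjective b⟩

/-- The extension of automorphisms of the Dynkin diagram to the extended Dynkin diagram. -/
noncomputable def extendAut : (dynkin b).aut →* (extendedDynkin b).aut :=
  ((restrictAut P (extendedIdx b)).comp (Subgroup.inclusion (rootStabilizer_simpleIdx_le b))).comp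
    (simpleAutEquiv b).symm.toMonoidHom

omit [P.IsIrreducible] in
theorem extendAut_simpleAutEquiv (g : rootStabilizer P (simpleIdx b)) :
    extendAut b (simpleAutEquiv b g) =
      restrictAut P (extendedIdx b) (Subgroup.inclusion (rootStabilizer_simpleIdx_le b) g) := by
  change restrictAut P (extendedIdx b) (Subgroup.inclusion _
    ((simpleAutEquiv b).symm (simpleAutEquiv b g))) = _
  rw [MulEquiv.symm_apply_apply]

omit [P.IsIrreducible] in
theorem extendAut_injective : Function.Injective (extendAut b) :=
  ((restrictAut_extended_injective b).comp (Subgroup.inclusion_injective _)).comp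
    (simpleAutEquiv b).symm.injective

omit [P.IsIrreducible] in
theorem extendAut_toExtended (θ : (dynkin b).aut) (i : simpleIdx b) :
    (extendAut b θ : Equiv.Perm (extendedIdx b)) (toExtended b i) =
      toExtended b ((θ : Equiv.Perm (simpleIdx b)) i) := by
  obtain ⟨g, rfl⟩ := (simpleAutEquiv b).surjective θ
  rw [extendAut_simpleAutEquiv]
  rfl

theorem mem_range_extendAut_iff (τ : (extendedDynkin b).aut) :
    τ ∈ (extendAut b).range ↔
      ∀ i : extendedIdx b, IsLowest b i → (τ : Equiv.Perm (extendedIdx b)) i = i := by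
  constructor
  · rintro ⟨θ, rfl⟩ i hi
    obtain ⟨g, rfl⟩ := (simpleAutEquiv b).surjective θ
    rw [extendAut_simpleAutEquiv]
    exact Subtype.ext (((isLowest_smul_iff g.2 _).mpr hi).eq hi)
  · intro hτ
    obtain ⟨g, rfl⟩ := restrictAut_extended_surjective b τ
    obtain ⟨ℓ, hℓ⟩ := exists_isLowest b
    have hgℓ : (g : P.Aut) • ℓ = ℓ := congrArg Subtype.val (hτ ⟨ℓ, Or.inr hℓ⟩ hℓ)
    have hg : (g : P.Aut) ∈ rootStabilizer P (simpleIdx b) := by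
      -- Permuting Π̂ while fixing -α₀ means permuting the remaining vertices Π.
      refine mem_rootStabilizer_of_forall_mem fun i hi => ?_
      refine ((g.2 i).mpr (Or.inl hi)).resolve_right fun h => ?_
      have h1 : i = ℓ := MulAction.injective (g : P.Aut) ((h.eq hℓ).trans hgℓ.symm)
      exact hℓ.notMem_support (h1 ▸ hi)
    exact ⟨simpleAutEquiv b ⟨g, hg⟩, extendAut_simpleAutEquiv b _⟩

/-- The common lift lies in W and preserves Π, hence is trivial. -/
theorem eq_one_of_omegaAction_eq (ω : Omega b) (θ : (dynkin b).aut)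
    (h : omegaAction b ω = extendAut b θ) : θ = 1 := by
  obtain ⟨g, rfl⟩ := (simpleAutEquiv b).surjective θ
  rw [extendAut_simpleAutEquiv] at h
  have h1 : (omegaWeyl b ω : P.Aut) = g :=
    congrArg Subtype.val (restrictAut_extended_injective b h)
  have h2 : (g : P.Aut) = 1 := by
    refine eq_one_of_smul_simple_mem b (h1 ▸ (omegaWeyl b ω).2) fun i hi => ?_
    rw [← root_smul]
    exact root_mem_posMonoid b ((g.2 i).mpr hi)
  rw [show g = 1 from Subtype.ext h2, map_one]

theorem exists_eq_omegaAction_mul (τ : (extendedDynkin b).aut) :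
    ∃ ω θ, τ = omegaAction b ω * extendAut b θ := by
  obtain ⟨g, rfl⟩ := restrictAut_extended_surjective b τ
  -- In g = w · (w⁻¹g) the second factor preserves Π, hence Π̂, as does g. So w preserves Π̂ and
  -- comes from Ω.
  obtain ⟨w, hw, hwg⟩ := exists_weyl_inv_mul_preserves b (g : P.Aut)
  let u : rootStabilizer P (simpleIdx b) := ⟨w⁻¹ * g, hwg⟩
  let u' := Subgroup.inclusion (rootStabilizer_simpleIdx_le b) u
  obtain ⟨ω, hω⟩ := restrictAut_mem_range_omegaAction b (g := g * u'⁻¹) (by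
    have : ((g * u'⁻¹ : rootStabilizer P (extendedIdx b)) : P.Aut) = w := by
      change (g : P.Aut) * (w⁻¹ * g)⁻¹ = w
      group
    rwa [this])
  refine ⟨ω, simpleAutEquiv b u, ?_⟩
  rw [hω, extendAut_simpleAutEquiv]
  change _ = restrictAut P (extendedIdx b) (g * u'⁻¹) * restrictAut P (extendedIdx b) u'
  rw [← map_mul, inv_mul_cancel_right]

end Main

end AffineDynkin

theorem mainTheorem6 {ι V V' : Type*} [Finite ι]
    [AddCommGroup V] [Module ℝ V] [AddCommGroup V'] [Module ℝ V']
    (P : RootPairing ι ℝ V V') [P.IsRootSystem] [P.IsCrystallographic] [P.IsReduced]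
    [P.IsIrreducible] (b : P.Base) :
    -- the action of `Ω` on the extended diagram, through the Weyl parts of its elements
    ∃ ρ : AffineDynkin.Omega b →* (AffineDynkin.extendedDynkin b).aut,
      (∀ ω : AffineDynkin.Omega b, ∀ v ∈ AffineDynkin.coweightLattice P, ∀ w : P.weylGroup,
        AffineDynkin.IsTranslateOf P (ω : V' ≃ᵃ[ℝ] V') v w →
          ∀ i : AffineDynkin.extendedIdx b,
            P.root ((ρ ω : Equiv.Perm (AffineDynkin.extendedIdx b)) i) = w • P.root i) ∧
      Function.Injective ρ ∧
      ∃ _ : ρ.range.Normal,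
      -- the inclusion of the automorphism group of the finite diagram
      ∃ e : (AffineDynkin.dynkin b).aut →* (AffineDynkin.extendedDynkin b).aut,
        (∀ (θ : (AffineDynkin.dynkin b).aut) (i : AffineDynkin.simpleIdx b),
          (e θ : Equiv.Perm (AffineDynkin.extendedIdx b)) (AffineDynkin.toExtended b i) =
            AffineDynkin.toExtended b ((θ : Equiv.Perm (AffineDynkin.simpleIdx b)) i)) ∧
        Function.Injective e ∧
        (∀ τ : (AffineDynkin.extendedDynkin b).aut, τ ∈ e.range ↔
          ∀ i : AffineDynkin.extendedIdx b, AffineDynkin.IsLowest b i →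
            (τ : Equiv.Perm (AffineDynkin.extendedIdx b)) i = i) ∧
        -- the quotient by `Ω`
        Function.Bijective ((QuotientGroup.mk' ρ.range).comp e) ∧
        -- the semidirect product decomposition
        ∃ φ : (AffineDynkin.dynkin b).aut →* MulAut (AffineDynkin.Omega b),
          ∃ Ψ : (AffineDynkin.Omega b ⋊[φ] (AffineDynkin.dynkin b).aut) ≃*
              (AffineDynkin.extendedDynkin b).aut,
            ∀ (ω : AffineDynkin.Omega b) (θ : (AffineDynkin.dynkin b).aut),
              Ψ ⟨ω, θ⟩ = ρ ω * e θ := by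
  have := AffineDynkin.omegaAction_range_normal b
  obtain ⟨hbij, hsemi⟩ := AffineDynkin.exists_semidirectProduct_mulEquiv
    (AffineDynkin.omegaAction b) (AffineDynkin.omegaAction_injective b) (AffineDynkin.extendAut b)
    (AffineDynkin.eq_one_of_omegaAction_eq b) (AffineDynkin.exists_eq_omegaAction_mul b)
  refine ⟨AffineDynkin.omegaAction b, fun ω v _ w hw i => ?_, AffineDynkin.omegaAction_injective b,
    this, AffineDynkin.extendAut b, AffineDynkin.extendAut_toExtended b,
    AffineDynkin.extendAut_injective b, AffineDynkin.mem_range_extendAut_iff b, hbij, hsemi⟩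
  rw [← AffineDynkin.omegaWeyl_eq b hw]
  exact AffineDynkin.root_smul (AffineDynkin.omegaWeyl b ω : P.Aut) i
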